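/- Let $U\subset\{(u^1,u^2)\in\mathbb R^2: u^1\neq 0\}$ be open and connected. Consider homogeneous first-order operators $P_1=g^{ij}(u)\,\partial_x+\Gamma^{ij}_k(u)\,u^k_x$ ($i,j,k\in\{1,2\}$) whose coefficients $g^{ij},\Gamma^{ij}_k$ are smooth on $U$, and the third-order operator $$R_3^{(2)}=\partial_x\begin{pmatrix}0&\partial_x\frac1{u^1}\\ \frac1{u^1}\partial_x& \frac{u^2}{(u^1)^2}\partial_x+\partial_x\frac{u^2}{(u^1)^2}\end{pmatrix}\partial_x .$$ An operator $P$ is called Hamiltonian if it is formally skew-adjoint and its Schouten bracket $[P,P]$ vanishes; $P_1$ is compatible with $R_3^{(2)}$ if $[P_1,R_3^{(2)}]=0$. Consider the following condition on $g$: $(\ast)$ there are constants $c_1,\dots,c_6\in\mathbb R$ such that on $U$ $$g^{11}=c_1u^1+c_2u^2,\qquad g^{12}=g^{21}=c_4u^1+\frac{c_3}{u^1}+\frac{c_2(u^2)^2}{2u^1},\qquad g^{22}=2c_4u^2+\frac{c_6}{u^1}-\frac{c_1(u^2)^2}{u^1}+c_5,$$ and $$c_2c_6+2c_1c_3=0,\qquad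 c_2c_5=0,\qquad c_1c_5=0.$$ Then: 1. For every smooth $(g^{ij})$ on $U$, possibly degenerate: there are smooth $\Gamma^{ij}_k$ on $U$ such that $P_1=g^{ij}\partial_x+\Gamma^{ij}_ku^k_x$ is Hamiltonian and compatible with $R_3^{(2)}$ if and only if $(\ast)$ holds. 2. If moreover $\det(g^{ij})\neq0$ everywhere on $U$, then for all smooth $\Gamma^{ij}_k$ on $U$: $P_1=g^{ij}\partial_x+\Gamma^{ij}_ku^k_x$ is Hamiltonian and compatible with $R_3^{(2)}$ if and only if $\Gamma^{ij}_k=-g^{il}\Gamma^j_{lk}$, where $\Gamma^j_{lk}$ are the Christoffel symbols of the Levi-Civita connection of $g$, and $(\ast)$ holds. -/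

import Mathlib

open scoped ContDiff

noncomputable section

namespace KdVType

/-- A point of the two-dimensional space of dependent variables: `v 0` is `u¹`, `v 1` is `u²`.
Indices `i j k : Fin 2` with values `0, 1` stand for the indices `1, 2`. -/
abbrev Pt : Type := Fin 2 → ℝ

/-- A field `x ↦ u(x)`, or a covector field `x ↦ ψ(x)`, along the real line. -/
abbrev Field1 : Type := ℝ → Pt

/-- A matrix differential operator whose coefficients depend on the field `u` and its
derivatives: `P u ψ` is the result of applying the operator, taken at the field `u`, to `ψ`. -/
abbrev FieldOp : Type := Field1 → Field1 → Field1

/-- The partial derivative `∂f/∂uᵏ` at the point `v`. -/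
def partialD (k : Fin 2) (f : Pt → ℝ) (v : Pt) : ℝ :=
  fderiv ℝ f v (Pi.single k 1)

/-- The homogeneous first-order operator `P₁ = gⁱʲ(u) ∂ₓ + Γⁱʲₖ(u) uᵏₓ`;
here `g v i j` is `gⁱʲ(v)` and `Γ v i j k` is `Γⁱʲₖ(v)`. -/
def firstOrderOp (g : Pt → Fin 2 → Fin 2 → ℝ) (Γ : Pt → Fin 2 → Fin 2 → Fin 2 → ℝ) : FieldOp :=
  fun u ψ x i =>
    ∑ j, (g (u x) i j * deriv (fun y => ψ y j) x
      + (∑ k, Γ (u x) i j k * deriv (fun y => u y k) x) * ψ x j)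

/-- The third-order operator
`∂ₓ ∘ [[0, ∂ₓ ∘ (1/u¹)], [(1/u¹) ∂ₓ, (u²/(u¹)²) ∂ₓ + ∂ₓ ∘ (u²/(u¹)²)]] ∘ ∂ₓ`. -/
def thirdOrderOp : FieldOp :=
  fun u ψ x =>
    ![deriv (fun y =>
        deriv (fun z => 1 / u z 0 * deriv (fun t => ψ t 1) z) y) x,
      deriv (fun y =>
        1 / u y 0 * deriv (fun z => deriv (fun t => ψ t 0) z) y
        + u y 1 / (u y 0) ^ 2 * deriv (fun z => deriv (fun t => ψ t 1) z) y
        + deriv (fun z => u z 1 / (u z 0) ^ 2 * deriv (fun t => ψ t 1) z) y) x]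

/-- A smooth field on the line with values in `U`. -/
def IsFieldIn (U : Set Pt) (u : Field1) : Prop :=
  ContDiff ℝ ∞ u ∧ ∀ x, u x ∈ U

/-- A test covector: smooth with compact support. -/
def IsTest (ψ : Field1) : Prop :=
  ContDiff ℝ ∞ ψ ∧ HasCompactSupport ψ

/-- The pairing `∫ φᵢ ξⁱ dx`. -/
def pairing (φ ξ : Field1) : ℝ :=
  ∫ x, ∑ i, φ x i * ξ x i

/-- The derivative of the coefficients of `P` at the field `u` in the direction of the
field variation `w`, applied to `ψ`: `(d/dε) P_{u + ε w} ψ` at `ε = 0`. -/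
def coeffDeriv (P : FieldOp) (u w ψ : Field1) : Field1 :=
  fun x i => deriv (fun ε : ℝ => P (u + ε • w) ψ x i) 0

/-- The operator is formally skew-adjoint. -/
def IsSkewAdjoint (U : Set Pt) (P : FieldOp) : Prop :=
  ∀ u φ ψ, IsFieldIn U u → IsTest φ → IsTest ψ →
    pairing φ (P u ψ) = -pairing ψ (P u φ)

/-- The cyclic sum over `(φ, ψ, χ)` of `∫ ⟨φ, (D P [Q ψ]) χ⟩ dx`. -/
def cyclicSum (P Q : FieldOp) (u φ ψ χ : Field1) : ℝ :=
  pairing φ (coeffDeriv P u (Q u ψ) χ)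
    + pairing ψ (coeffDeriv P u (Q u χ) φ)
    + pairing χ (coeffDeriv P u (Q u φ) ψ)

/-- The Schouten bracket `[P, Q]` of two skew-adjoint operators, as a trilinear form in the
test covectors `φ, ψ, χ`, at the field `u`. -/
def schouten (P Q : FieldOp) (u φ ψ χ : Field1) : ℝ :=
  cyclicSum P Q u φ ψ χ + cyclicSum Q P u φ ψ χ

/-- The Schouten bracket `[P, Q]` vanishes, for fields with values in `U`. -/
def SchoutenCommute (U : Set Pt) (P Q : FieldOp) : Prop :=
  ∀ u φ ψ χ, IsFieldIn U u → IsTest φ → IsTest ψ → IsTest χ → schouten P Q u φ ψ χ = 0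

/-- `P` is a Hamiltonian operator: the bracket `{F, G} = ∫ (δF/δuⁱ) Pⁱʲ (δG/δuʲ) dx`
is skew-symmetric and satisfies the Jacobi identity, that is, `P` is skew-adjoint
and `[P, P] = 0`. -/
def IsHamiltonian (U : Set Pt) (P : FieldOp) : Prop :=
  IsSkewAdjoint U P ∧ SchoutenCommute U P P

/-- The coefficients `g` are smooth on `U`. -/
def SmoothMetric (U : Set Pt) (g : Pt → Fin 2 → Fin 2 → ℝ) : Prop :=
  ∀ i j, ContDiffOn ℝ ∞ (fun v => g v i j) U

/-- The coefficients `Γ` are smooth on `U`. -/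
def SmoothSymbols (U : Set Pt) (Γ : Pt → Fin 2 → Fin 2 → Fin 2 → ℝ) : Prop :=
  ∀ i j k, ContDiffOn ℝ ∞ (fun v => Γ v i j k) U

/-- `Γⁱʲₖ = -gⁱˡ Γʲₗₖ`, where `Γʲₗₖ` (written `C v j l k`) are the Christoffel symbols of the
Levi-Civita connection of the symmetric contravariant metric `gⁱʲ`: the connection is
torsion-free and `∇ g = 0`. -/
def IsLeviCivita (U : Set Pt) (g : Pt → Fin 2 → Fin 2 → ℝ)
    (Γ : Pt → Fin 2 → Fin 2 → Fin 2 → ℝ) : Prop :=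
  (∀ v ∈ U, ∀ i j, g v i j = g v j i) ∧
  ∃ C : Pt → Fin 2 → Fin 2 → Fin 2 → ℝ, ∀ v ∈ U,
    (∀ j l k, C v j l k = C v j k l) ∧
    (∀ i j k, partialD k (fun w => g w i j) v
      + ∑ l, C v i k l * g v l j + ∑ l, C v j k l * g v i l = 0) ∧
    (∀ i j k, Γ v i j k = -∑ l, g v i l * C v j l k)

/-- On `U`, the symmetric matrix `g` has the stated rational form, with constants
`c₁, …, c₆` that satisfy the three quadratic conditions. -/
def HasRationalForm (U : Set Pt) (g : Pt → Fin 2 → Fin 2 → ℝ) : Prop :=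
  ∃ c₁ c₂ c₃ c₄ c₅ c₆ : ℝ,
    (∀ v ∈ U,
      g v 0 0 = c₁ * v 0 + c₂ * v 1 ∧
      g v 0 1 = c₄ * v 0 + c₃ / v 0 + c₂ * (v 1) ^ 2 / (2 * v 0) ∧
      g v 1 0 = g v 0 1 ∧
      g v 1 1 = 2 * c₄ * v 1 + c₆ / v 0 - c₁ * (v 1) ^ 2 / v 0 + c₅) ∧
    c₂ * c₆ + 2 * c₁ * c₃ = 0 ∧ c₂ * c₅ = 0 ∧ c₁ * c₅ = 0

end KdVType

end

/-!
Write `P` for the first-order operator with coefficients `g`, `Γ`, and `R` for the third-order one.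
Everything is reduced to pointwise statements about `g` and `Γ`.

**Reduction.** `P` is skew-adjoint exactly when `g` is symmetric and `∂ₖgⁱʲ = Γⁱʲₖ + Γʲⁱₖ`
(`SkewCoeffs`). Then integration by parts moves all derivatives off the field variation:
`∫ ⟨φ, (DP[w]) χ⟩ = ∫ Mₖ(φ, χ) wᵏ` and `∫ ⟨φ, (DR[w]) χ⟩ = ∫ Nₖ(φ, χ) wᵏ`, with explicit forms
`M` (`firstForm`) and `N` (`thirdForm`). So `[P, P]` is `2 ∫ ∑ M(φ, χ)·Pψ` and `[P, R]` is
`∫ ∑ (N(φ, χ)·Pψ + M(φ, χ)·Rψ)`, the sums being cyclic (`schouten_first_first`,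
`schouten_first_third`).

**Sufficiency.** For `g` of rational form there are explicit symbols (`rationalSymbols`). They are
curl-free in the lower index, and the three quadratic relations between the constants make
`Γʲⁱₖ gᵏᵐ` symmetric in `j, m` and `Γʲⁱₖ Γᵏᵐₗ` symmetric in `i, m`; hence the density of `[P, P]`
vanishes identically (`sum_firstDensity_eq_zero`). The density of `[P, R]`
is the derivative of an explicit differential polynomial (`flux`).

**Necessity.** Take `φ = ρ f` with a bump `ρ`, let `ψ` and `χ` agree with monomials near the
support of `ρ`, and let the field be constant or of the form `v + x³ q` there (`v + x q` for
skew-adjointness). The bracket becomes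
`∫ ∑ₙ xⁿ Kₙ(x) ρ⁽ⁿ⁾(x) dx`; concentrating `ρ` at the origin gives `∑ₙ (-1)ⁿ n! Kₙ(0) = 0`
(`moments_eq_zero`). A suitable choice of the degrees isolates one relation at a time: the symmetry
of `Γʲⁱₖ gᵏᵐ` from `[P, P]`, and from `[P, R]` two algebraic relations
(`symbols_relation_of_quartic`, `symbols_relation_of_quadratic`) and one on the first derivatives
of `Γ` (`symbols_derivative_relation`). The last one says that `Γ¹ʲₖ` is constant, and together they
determine the gradient of every coefficient. The constants `c₁, …, c₆` appear as functions with
zero gradient on the connected set `U`; the quadratic relations between them are the symmetry of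
`Γʲⁱₖ gᵏᵐ` (`exists_isRational`). Nothing is divided by `det g`, so `g` may be degenerate.

**Non-degenerate metrics.** If `det g ≠ 0`, the Levi-Civita condition is equivalent to
`SkewCoeffs` together with the symmetry of `Γʲⁱₖ gᵏᵐ` (the latter is the absence of torsion), and
these two determine `Γ` (`symbols_unique`); so `Γ` has to be `rationalSymbols`.
-/

noncomputable section

namespace KdVType

open MeasureTheory Set Filter Topology

/-! ### Jets of fields -/

/-- The `n`-th derivative of the `i`-th component of a field. -/
def jet (f : Field1) (n : ℕ) (i : Fin 2) (x : ℝ) : ℝ := iteratedDeriv n (fun y => f y i) x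

lemma jet_zero (f : Field1) (i : Fin 2) : jet f 0 i = fun x => f x i := by
  funext x; simp [jet]

lemma contDiff_component {f : Field1} (hf : ContDiff ℝ ∞ f) (i : Fin 2) :
    ContDiff ℝ ∞ (fun y => f y i) := contDiff_pi.1 hf i

lemma deriv_jet (f : Field1) (n : ℕ) (i : Fin 2) : deriv (jet f n i) = jet f (n + 1) i := by
  funext x; exact congrFun iteratedDeriv_succ.symm x

lemma deriv_component (f : Field1) (i : Fin 2) : deriv (fun y => f y i) = jet f 1 i := by
  rw [← jet_zero, deriv_jet]

lemma contDiff_jet {f : Field1} (hf : ContDiff ℝ ∞ f) (n : ℕ) (i : Fin 2) :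
    ContDiff ℝ ∞ (jet f n i) := by
  have h := (contDiff_component hf i).iterate_deriv n
  rwa [← iteratedDeriv_eq_iterate] at h

lemma hasDerivAt_jet {f : Field1} (hf : ContDiff ℝ ∞ f) (n : ℕ) (i : Fin 2) (x : ℝ) :
    HasDerivAt (jet f n i) (jet f (n + 1) i x) x := by
  rw [← deriv_jet]
  exact ((contDiff_jet hf n i).differentiable (by simp) x).hasDerivAt

lemma hasDerivAt_component {f : Field1} (hf : ContDiff ℝ ∞ f) (i : Fin 2) (x : ℝ) :
    HasDerivAt (fun y => f y i) (jet f 1 i x) x := by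
  simpa [jet_zero] using hasDerivAt_jet hf 0 i x

lemma continuous_jet {f : Field1} (hf : ContDiff ℝ ∞ f) (n : ℕ) (i : Fin 2) :
    Continuous (jet f n i) := (contDiff_jet hf n i).continuous

lemma jet_congr {f h : Field1} {x : ℝ} (e : f =ᶠ[𝓝 x] h) (n : ℕ) (i : Fin 2) :
    jet f n i x = jet h n i x :=
  Filter.EventuallyEq.iteratedDeriv_eq n (e.mono fun y hy => by simp only [hy])

lemma jet_eq_zero {f : Field1} {x : ℝ} (hx : x ∉ tsupport f) (n : ℕ) (i : Fin 2) :
    jet f n i x = 0 := by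
  rw [jet_congr (notMem_tsupport_iff_eventuallyEq.1 hx)]
  change iteratedDeriv n (fun _ => (0 : ℝ)) x = 0
  simp

lemma apply_eq_zero {f : Field1} {x : ℝ} (hx : x ∉ tsupport f) (i : Fin 2) : f x i = 0 := by
  rw [image_eq_zero_of_notMem_tsupport hx]; rfl

lemma jet_add_smul {u w : Field1} (hu : ContDiff ℝ ∞ u) (hw : ContDiff ℝ ∞ w) (ε : ℝ)
    (n : ℕ) (i : Fin 2) (x : ℝ) :
    jet (u + ε • w) n i x = jet u n i x + ε * jet w n i x := by
  have h1 := ((contDiff_component hu i).of_le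
    (show (n : WithTop ℕ∞) ≤ ∞ by exact_mod_cast le_top)).contDiffAt (x := x)
  have h2 := ((contDiff_component hw i).of_le
    (show (n : WithTop ℕ∞) ≤ ∞ by exact_mod_cast le_top)).contDiffAt (x := x)
  have h3 : ContDiffAt ℝ n (ε • fun y => w y i) x := contDiffAt_const.smul h2
  change iteratedDeriv n ((fun y => u y i) + ε • fun y => w y i) x = _
  rw [iteratedDeriv_add h1 h3, iteratedDeriv_const_smul h2]
  rfl

/-- Jets of a scalar function times a constant vector. -/
lemma jet_smul_const {r : ℝ → ℝ} (hr : ContDiff ℝ ∞ r) (f : Pt) (n : ℕ) (i : Fin 2) (x : ℝ) :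
    jet (fun y => r y • f) n i x = iteratedDeriv n r x * f i := by
  have h := (hr.of_le (show (n : WithTop ℕ∞) ≤ ∞ by exact_mod_cast le_top)).contDiffAt (x := x)
  have : (fun y => (r y • f) i) = f i • r := by
    funext y; simp [mul_comm]
  rw [jet, this, iteratedDeriv_const_smul h, smul_eq_mul, mul_comm]

/-! ### Integrals of total derivatives -/

/-- Two continuous integrands that differ by the derivative of a compactly supported function
have the same integral. -/
lemma integral_eq_of_hasDerivAt {F G S : ℝ → ℝ} {K : Set ℝ} (hK : IsCompact K)
    (hF : Continuous F) (hG : Continuous G)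
    (hF0 : ∀ x ∉ K, F x = 0) (hG0 : ∀ x ∉ K, G x = 0) (hS0 : ∀ x ∉ K, S x = 0)
    (hS : ∀ x, HasDerivAt S (F x - G x) x) : ∫ x, F x = ∫ x, G x := by
  have iF := hF.integrable_of_hasCompactSupport (μ := volume) (HasCompactSupport.intro hK hF0)
  have iG := hG.integrable_of_hasCompactSupport (μ := volume) (HasCompactSupport.intro hK hG0)
  have hSc : Continuous S := continuous_iff_continuousAt.2 fun x => (hS x).continuousAt
  have iS := hSc.integrable_of_hasCompactSupport (μ := volume) (HasCompactSupport.intro hK hS0)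
  have h := integral_eq_zero_of_hasDerivAt_of_integrable hS (iF.sub iG) iS
  rw [integral_sub iF iG] at h
  linarith

/-! ### Partial derivatives on the space of dependent variables -/

/-- `f` is differentiable at `v` with partial derivatives `d 0`, `d 1`. Differentiability is part of
the definition, since `partialD` is `0` where it fails. -/
def HasPartials (f : Pt → ℝ) (d : Fin 2 → ℝ) (v : Pt) : Prop :=
  DifferentiableAt ℝ f v ∧ ∀ k, partialD k f v = d k

namespace HasPartials

variable {f h : Pt → ℝ} {d e : Fin 2 → ℝ} {v : Pt}

lemma of_hasFDerivAt {L : Pt →L[ℝ] ℝ} (hL : HasFDerivAt f L v)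
    (hd : ∀ k, L (Pi.single k 1) = d k) : HasPartials f d v :=
  ⟨hL.differentiableAt, fun k => by rw [partialD, hL.fderiv, hd]⟩

lemma congr_partials (hf : HasPartials f d v) (hde : ∀ k, d k = e k) : HasPartials f e v :=
  ⟨hf.1, fun k => (hf.2 k).trans (hde k)⟩

lemma const (c : ℝ) : HasPartials (fun _ => c) (fun _ => 0) v :=
  of_hasFDerivAt (hasFDerivAt_const c v) (by simp)

lemma coord (i : Fin 2) : HasPartials (fun v => v i) (fun k => if k = i then 1 else 0) v :=
  of_hasFDerivAt (hasFDerivAt_apply i v) (by intro k; simp [Pi.single_apply, eq_comm])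

lemma add (hf : HasPartials f d v) (hh : HasPartials h e v) :
    HasPartials (fun w => f w + h w) (fun k => d k + e k) v :=
  of_hasFDerivAt (hf.1.hasFDerivAt.fun_add hh.1.hasFDerivAt) fun k => by
    simp [← hf.2, ← hh.2, partialD]

lemma sub (hf : HasPartials f d v) (hh : HasPartials h e v) :
    HasPartials (fun w => f w - h w) (fun k => d k - e k) v :=
  of_hasFDerivAt (hf.1.hasFDerivAt.fun_sub hh.1.hasFDerivAt) fun k => by
    simp [← hf.2, ← hh.2, partialD]

lemma mul (hf : HasPartials f d v) (hh : HasPartials h e v) :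
    HasPartials (fun w => f w * h w) (fun k => d k * h v + f v * e k) v :=
  of_hasFDerivAt (hf.1.hasFDerivAt.mul hh.1.hasFDerivAt) fun k => by
    simp [← hf.2, ← hh.2, partialD]; ring

lemma inv (hf : HasPartials f d v) (h0 : f v ≠ 0) :
    HasPartials (fun w => (f w)⁻¹) (fun k => -d k * (f v)⁻¹ ^ 2) v :=
  of_hasFDerivAt ((hasFDerivAt_inv h0).comp v hf.1.hasFDerivAt) fun k => by
    simp [← hf.2, partialD]

lemma congr (hf : HasPartials f d v) (he : f =ᶠ[𝓝 v] h) : HasPartials h d v :=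
  ⟨hf.1.congr_of_eventuallyEq he.symm, fun k => by
    rw [← hf.2 k, partialD, partialD, he.fderiv_eq]⟩

end HasPartials

section
variable {U : Set Pt}

lemma fderiv_apply_eq {f : Pt → ℝ} {v : Pt} (w : Pt) :
    fderiv ℝ f v w = ∑ k, partialD k f v * w k := by
  have hw : w = ∑ k, w k • (Pi.single k (1 : ℝ) : Pt) := by
    funext i; simp [Finset.sum_apply, Pi.single_apply]
  conv_lhs => rw [hw]
  simp [partialD, mul_comm]

lemma differentiableAt_of_smooth {f : Pt → ℝ} (hU : IsOpen U) (hf : ContDiffOn ℝ ∞ f U)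
    {v : Pt} (hv : v ∈ U) : DifferentiableAt ℝ f v :=
  (hf.contDiffAt (hU.mem_nhds hv)).differentiableAt (by simp)

lemma contDiffOn_partialD {f : Pt → ℝ} (hU : IsOpen U) (hf : ContDiffOn ℝ ∞ f U) (k : Fin 2) :
    ContDiffOn ℝ ∞ (partialD k f) U :=
  (hf.fderiv_of_isOpen hU (m := ∞) (by simp)).clm_apply contDiffOn_const

lemma contDiff_along {f : Pt → ℝ} (hU : IsOpen U) (hf : ContDiffOn ℝ ∞ f U) {u : Field1}
    (hu : IsFieldIn U u) : ContDiff ℝ ∞ (fun x => f (u x)) :=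
  contDiff_iff_contDiffAt.2 fun x =>
    (hf.contDiffAt (hU.mem_nhds (hu.2 x))).comp x hu.1.contDiffAt

/-- The chain rule along a curve of the form `ε ↦ v + ε w`. -/
lemma hasDerivAt_line {f : Pt → ℝ} {v w : Pt} (hf : DifferentiableAt ℝ f v) :
    HasDerivAt (fun ε : ℝ => f (v + ε • w)) (∑ k, partialD k f v * w k) 0 := by
  have h1 : HasDerivAt (fun ε : ℝ => v + ε • w) w 0 := by
    simpa using ((hasDerivAt_id (0 : ℝ)).smul_const w).const_add v
  have h2 : HasFDerivAt f (fderiv ℝ f v) (v + (0 : ℝ) • w) := by simpa using hf.hasFDerivAt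
  rw [← fderiv_apply_eq]
  exact h2.comp_hasDerivAt 0 h1

lemma hasDerivAt_along {f : Pt → ℝ} (hU : IsOpen U) (hf : ContDiffOn ℝ ∞ f U) {u : Field1}
    (hu : IsFieldIn U u) (x : ℝ) :
    HasDerivAt (fun y => f (u y)) (∑ k, partialD k f (u x) * jet u 1 k x) x := by
  have h1 : HasDerivAt u (fun k => jet u 1 k x) x :=
    hasDerivAt_pi.2 fun k => hasDerivAt_component hu.1 k x
  rw [← fderiv_apply_eq]
  exact (differentiableAt_of_smooth hU hf (hu.2 x)).hasFDerivAt.comp_hasDerivAt x h1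

end

/-! ### The operators in terms of jets -/

/-- The derivatives of order `0`, `1` and (for every larger index) `2` of `1/u¹` along a field. -/
def recipJet (u : Field1) : ℕ → ℝ → ℝ
  | 0, x => (u x 0)⁻¹
  | 1, x => -(u x 0)⁻¹ ^ 2 * jet u 1 0 x
  | _, x => 2 * (u x 0)⁻¹ ^ 3 * jet u 1 0 x ^ 2 - (u x 0)⁻¹ ^ 2 * jet u 2 0 x

/-- The derivatives of order `0`, `1` and (for every larger index) `2` of `u²/(u¹)²` along a
field. -/
def ratioJet (u : Field1) : ℕ → ℝ → ℝ
  | 0, x => u x 1 * (u x 0)⁻¹ ^ 2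
  | 1, x => jet u 1 1 x * (u x 0)⁻¹ ^ 2 - 2 * u x 1 * (u x 0)⁻¹ ^ 3 * jet u 1 0 x
  | _, x => jet u 2 1 x * (u x 0)⁻¹ ^ 2 - 4 * jet u 1 1 x * (u x 0)⁻¹ ^ 3 * jet u 1 0 x
      + 6 * u x 1 * (u x 0)⁻¹ ^ 4 * jet u 1 0 x ^ 2 - 2 * u x 1 * (u x 0)⁻¹ ^ 3 * jet u 2 0 x

section
variable {u : Field1} {x : ℝ}

lemma hasDerivAt_recip (hu : ContDiff ℝ ∞ u) (h0 : u x 0 ≠ 0) :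
    HasDerivAt (fun y => (u y 0)⁻¹) (-(u x 0)⁻¹ ^ 2 * jet u 1 0 x) x := by
  refine HasDerivAt.congr_deriv ((hasDerivAt_component hu 0 x).fun_inv h0) ?_
  field_simp

lemma hasDerivAt_recipJet_zero (hu : ContDiff ℝ ∞ u) (h0 : u x 0 ≠ 0) :
    HasDerivAt (recipJet u 0) (recipJet u 1 x) x := hasDerivAt_recip hu h0

lemma hasDerivAt_recipJet_one (hu : ContDiff ℝ ∞ u) (h0 : u x 0 ≠ 0) :
    HasDerivAt (recipJet u 1) (recipJet u 2 x) x := by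
  refine HasDerivAt.congr_deriv
    (((hasDerivAt_recip hu h0).pow 2).neg.mul (hasDerivAt_jet hu 1 0 x)) ?_
  simp only [recipJet]; push_cast; simp; ring

lemma hasDerivAt_ratioJet_zero (hu : ContDiff ℝ ∞ u) (h0 : u x 0 ≠ 0) :
    HasDerivAt (ratioJet u 0) (ratioJet u 1 x) x := by
  refine HasDerivAt.congr_deriv
    ((hasDerivAt_component hu 1 x).mul ((hasDerivAt_recip hu h0).pow 2)) ?_
  simp only [ratioJet]; push_cast; simp; ring

lemma hasDerivAt_ratioJet_one (hu : ContDiff ℝ ∞ u) (h0 : u x 0 ≠ 0) :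
    HasDerivAt (ratioJet u 1) (ratioJet u 2 x) x := by
  refine HasDerivAt.congr_deriv
    (((hasDerivAt_jet hu 1 1 x).mul ((hasDerivAt_recip hu h0).pow 2)).sub
    ((((hasDerivAt_component hu 1 x).const_mul 2).mul ((hasDerivAt_recip hu h0).pow 3)).mul
      (hasDerivAt_jet hu 1 0 x))) ?_
  simp only [ratioJet]; push_cast; simp; ring

lemma eventually_ne (hu : ContDiff ℝ ∞ u) (h0 : u x 0 ≠ 0) : ∀ᶠ y in 𝓝 x, u y 0 ≠ 0 :=
  ((contDiff_component hu 0).continuous.continuousAt).eventually_ne h0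

variable {ψ : Field1}

lemma thirdOrderOp_apply_zero (hu : ContDiff ℝ ∞ u) (hψ : ContDiff ℝ ∞ ψ) (h0 : u x 0 ≠ 0) :
    thirdOrderOp u ψ x 0 = recipJet u 2 x * jet ψ 1 1 x + 2 * recipJet u 1 x * jet ψ 2 1 x
      + recipJet u 0 x * jet ψ 3 1 x := by
  simp only [thirdOrderOp, Matrix.cons_val_zero, deriv_component]
  have h1 : ∀ y, u y 0 ≠ 0 → HasDerivAt (fun z => 1 / u z 0 * jet ψ 1 1 z)
      (recipJet u 1 y * jet ψ 1 1 y + recipJet u 0 y * jet ψ 2 1 y) y := by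
    intro y hy
    simp only [one_div]
    exact (hasDerivAt_recipJet_zero hu hy).mul (hasDerivAt_jet hψ 1 1 y)
  have h2 : (fun y => deriv (fun z => 1 / u z 0 * jet ψ 1 1 z) y) =ᶠ[𝓝 x]
      fun y => recipJet u 1 y * jet ψ 1 1 y + recipJet u 0 y * jet ψ 2 1 y :=
    (eventually_ne hu h0).mono fun y hy => (h1 y hy).deriv
  rw [h2.deriv_eq]
  refine ((((hasDerivAt_recipJet_one hu h0).mul (hasDerivAt_jet hψ 1 1 x)).add
    ((hasDerivAt_recipJet_zero hu h0).mul (hasDerivAt_jet hψ 2 1 x))).deriv).trans ?_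
  ring

lemma thirdOrderOp_apply_one (hu : ContDiff ℝ ∞ u) (hψ : ContDiff ℝ ∞ ψ) (h0 : u x 0 ≠ 0) :
    thirdOrderOp u ψ x 1 = recipJet u 1 x * jet ψ 2 0 x + recipJet u 0 x * jet ψ 3 0 x
      + ratioJet u 2 x * jet ψ 1 1 x + 3 * ratioJet u 1 x * jet ψ 2 1 x
      + 2 * ratioJet u 0 x * jet ψ 3 1 x := by
  simp only [thirdOrderOp, Matrix.cons_val_one, deriv_component, deriv_jet, Matrix.cons_val_fin_one]
  have h1 : ∀ y, u y 0 ≠ 0 → HasDerivAt (fun z => u z 1 / u z 0 ^ 2 * jet ψ 1 1 z)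
      (ratioJet u 1 y * jet ψ 1 1 y + ratioJet u 0 y * jet ψ 2 1 y) y := by
    intro y hy
    simp only [div_eq_mul_inv, ← inv_pow]
    exact (hasDerivAt_ratioJet_zero hu hy).mul (hasDerivAt_jet hψ 1 1 y)
  have h2 : (fun y => 1 / u y 0 * jet ψ (1 + 1) 0 y + u y 1 / u y 0 ^ 2 * jet ψ (1 + 1) 1 y
      + deriv (fun z => u z 1 / u z 0 ^ 2 * jet ψ 1 1 z) y) =ᶠ[𝓝 x]
      fun y => recipJet u 0 y * jet ψ 2 0 y + 2 * (ratioJet u 0 y * jet ψ 2 1 y)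
        + ratioJet u 1 y * jet ψ 1 1 y :=
    (eventually_ne hu h0).mono fun y hy => by
      dsimp only
      rw [(h1 y hy).deriv]; simp only [recipJet, ratioJet]; ring
  rw [h2.deriv_eq]
  refine ((((hasDerivAt_recipJet_zero hu h0).mul (hasDerivAt_jet hψ 2 0 x)).add
    (((hasDerivAt_ratioJet_zero hu h0).mul (hasDerivAt_jet hψ 2 1 x)).const_mul 2)).add
    ((hasDerivAt_ratioJet_one hu h0).mul (hasDerivAt_jet hψ 1 1 x))).deriv.trans ?_
  ring

lemma firstOrderOp_apply (g : Pt → Fin 2 → Fin 2 → ℝ) (Γ : Pt → Fin 2 → Fin 2 → Fin 2 → ℝ)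
    (u ψ : Field1) (x : ℝ) (i : Fin 2) :
    firstOrderOp g Γ u ψ x i = ∑ j, (g (u x) i j * jet ψ 1 j x
      + (∑ k, Γ (u x) i j k * jet u 1 k x) * ψ x j) := by
  simp only [firstOrderOp, deriv_component]

end

/-! ### Coefficient derivatives -/

section
variable {u w χ : Field1} {x : ℝ}

/-- The variation of `1/u¹` in the direction `w`. -/
def recipVar (u w : Field1) (x : ℝ) : ℝ := -(u x 0)⁻¹ ^ 2 * w x 0

/-- The variation of `u²/(u¹)²` in the direction `w`. -/
def ratioVar (u w : Field1) (x : ℝ) : ℝ :=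
  (u x 0)⁻¹ ^ 2 * w x 1 - 2 * u x 1 * (u x 0)⁻¹ ^ 3 * w x 0

/-- The derivatives of order `1` and (for every other index) `2` of `recipVar`. -/
def recipVarJet (u w : Field1) : ℕ → ℝ → ℝ
  | 1, x => 2 * (u x 0)⁻¹ ^ 3 * jet u 1 0 x * w x 0 - (u x 0)⁻¹ ^ 2 * jet w 1 0 x
  | _, x => -6 * (u x 0)⁻¹ ^ 4 * jet u 1 0 x ^ 2 * w x 0 + 2 * (u x 0)⁻¹ ^ 3 * jet u 2 0 x * w x 0
      + 4 * (u x 0)⁻¹ ^ 3 * jet u 1 0 x * jet w 1 0 x - (u x 0)⁻¹ ^ 2 * jet w 2 0 x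

/-- The derivatives of order `1` and (for every other index) `2` of `ratioVar`. -/
def ratioVarJet (u w : Field1) : ℕ → ℝ → ℝ
  | 1, x => -2 * (u x 0)⁻¹ ^ 3 * jet u 1 0 x * w x 1 + (u x 0)⁻¹ ^ 2 * jet w 1 1 x
      - 2 * jet u 1 1 x * (u x 0)⁻¹ ^ 3 * w x 0
      + 6 * u x 1 * (u x 0)⁻¹ ^ 4 * jet u 1 0 x * w x 0
      - 2 * u x 1 * (u x 0)⁻¹ ^ 3 * jet w 1 0 x
  | _, x => 6 * (u x 0)⁻¹ ^ 4 * jet u 1 0 x ^ 2 * w x 1 - 2 * (u x 0)⁻¹ ^ 3 * jet u 2 0 x * w x 1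
      - 4 * (u x 0)⁻¹ ^ 3 * jet u 1 0 x * jet w 1 1 x + (u x 0)⁻¹ ^ 2 * jet w 2 1 x
      - 2 * jet u 2 1 x * (u x 0)⁻¹ ^ 3 * w x 0
      + 12 * jet u 1 1 x * (u x 0)⁻¹ ^ 4 * jet u 1 0 x * w x 0
      - 4 * jet u 1 1 x * (u x 0)⁻¹ ^ 3 * jet w 1 0 x
      - 24 * u x 1 * (u x 0)⁻¹ ^ 5 * jet u 1 0 x ^ 2 * w x 0
      + 6 * u x 1 * (u x 0)⁻¹ ^ 4 * jet u 2 0 x * w x 0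
      + 12 * u x 1 * (u x 0)⁻¹ ^ 4 * jet u 1 0 x * jet w 1 0 x
      - 2 * u x 1 * (u x 0)⁻¹ ^ 3 * jet w 2 0 x

lemma hasDerivAt_recipVar (hu : ContDiff ℝ ∞ u) (hw : ContDiff ℝ ∞ w) (h0 : u x 0 ≠ 0) :
    HasDerivAt (recipVar u w) (recipVarJet u w 1 x) x := by
  refine HasDerivAt.congr_deriv
    (((hasDerivAt_recip hu h0).pow 2).neg.mul (hasDerivAt_component hw 0 x)) ?_
  simp only [recipVarJet]; push_cast; simp; ring

lemma hasDerivAt_recipVarJet (hu : ContDiff ℝ ∞ u) (hw : ContDiff ℝ ∞ w) (h0 : u x 0 ≠ 0) :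
    HasDerivAt (recipVarJet u w 1) (recipVarJet u w 2 x) x := by
  have ha := hasDerivAt_recip hu h0
  refine HasDerivAt.congr_deriv (((((ha.pow 3).const_mul 2).mul (hasDerivAt_jet hu 1 0 x)).mul
    (hasDerivAt_component hw 0 x)).sub ((ha.pow 2).mul (hasDerivAt_jet hw 1 0 x))) ?_
  simp only [recipVarJet]; push_cast; simp; ring

lemma hasDerivAt_ratioVar (hu : ContDiff ℝ ∞ u) (hw : ContDiff ℝ ∞ w) (h0 : u x 0 ≠ 0) :
    HasDerivAt (ratioVar u w) (ratioVarJet u w 1 x) x := by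
  have ha := hasDerivAt_recip hu h0
  refine HasDerivAt.congr_deriv (((ha.pow 2).mul (hasDerivAt_component hw 1 x)).sub
    ((((hasDerivAt_component hu 1 x).const_mul 2).mul (ha.pow 3)).mul
      (hasDerivAt_component hw 0 x))) ?_
  simp only [ratioVarJet]; push_cast; simp; ring

lemma hasDerivAt_ratioVarJet (hu : ContDiff ℝ ∞ u) (hw : ContDiff ℝ ∞ w) (h0 : u x 0 ≠ 0) :
    HasDerivAt (ratioVarJet u w 1) (ratioVarJet u w 2 x) x := by
  have ha := hasDerivAt_recip hu h0
  have u1 := hasDerivAt_jet hu 1 0 x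
  have v0 := hasDerivAt_component hu 1 x
  have v1 := hasDerivAt_jet hu 1 1 x
  have w0 := hasDerivAt_component hw 0 x
  have z0 := hasDerivAt_component hw 1 x
  refine HasDerivAt.congr_deriv ((((((((ha.pow 3).const_mul (-2)).mul u1).mul z0).add
    ((ha.pow 2).mul (hasDerivAt_jet hw 1 1 x))).sub
    (((v1.const_mul 2).mul (ha.pow 3)).mul w0)).add
    ((((v0.const_mul 6).mul (ha.pow 4)).mul u1).mul w0)).sub
    (((v0.const_mul 2).mul (ha.pow 3)).mul (hasDerivAt_jet hw 1 0 x))) ?_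
  simp only [ratioVarJet]; push_cast; simp; ring

/-- Only finitely many derivatives of the field enter the operator, each of them affine in `ε`;
so the variation can be computed at a single point `x`. -/
lemma hasDerivAt_variation (hu : ContDiff ℝ ∞ u) (hw : ContDiff ℝ ∞ w) (h0 : u x 0 ≠ 0) :
    HasDerivAt (fun ε : ℝ => recipJet (u + ε • w) 0 x) (recipVar u w x) 0 ∧
    HasDerivAt (fun ε : ℝ => recipJet (u + ε • w) 1 x) (recipVarJet u w 1 x) 0 ∧
    HasDerivAt (fun ε : ℝ => recipJet (u + ε • w) 2 x) (recipVarJet u w 2 x) 0 ∧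
    HasDerivAt (fun ε : ℝ => ratioJet (u + ε • w) 0 x) (ratioVar u w x) 0 ∧
    HasDerivAt (fun ε : ℝ => ratioJet (u + ε • w) 1 x) (ratioVarJet u w 1 x) 0 ∧
    HasDerivAt (fun ε : ℝ => ratioJet (u + ε • w) 2 x) (ratioVarJet u w 2 x) 0 := by
  have hl : ∀ c d : ℝ, HasDerivAt (fun ε : ℝ => c + ε * d) d 0 := fun c d => by
    simpa using ((hasDerivAt_id (0 : ℝ)).mul_const d).const_add c
  have ha : HasDerivAt (fun ε : ℝ => (u x 0 + ε * w x 0)⁻¹) (-(u x 0)⁻¹ ^ 2 * w x 0) 0 := by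
    refine HasDerivAt.congr_deriv ((hl (u x 0) (w x 0)).fun_inv (by simpa using h0)) ?_
    simp; field_simp
  have hp := fun n => ha.pow n
  have v0 := hl (u x 1) (w x 1)
  have u1 := hl (jet u 1 0 x) (jet w 1 0 x)
  have v1 := hl (jet u 1 1 x) (jet w 1 1 x)
  have u2 := hl (jet u 2 0 x) (jet w 2 0 x)
  have v2 := hl (jet u 2 1 x) (jet w 2 1 x)
  have e : ∀ (ε : ℝ) (i : Fin 2), (u + ε • w) x i = u x i + ε * w x i := fun ε i => rfl
  simp only [recipJet, ratioJet, jet_add_smul hu hw, e]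
  refine ⟨ha, ?_, ?_, ?_, ?_, ?_⟩
  · refine HasDerivAt.congr_deriv ((hp 2).neg.mul u1) ?_
    simp only [recipVarJet]; push_cast; simp; ring
  · refine HasDerivAt.congr_deriv ((((hp 3).const_mul 2).mul (u1.pow 2)).sub ((hp 2).mul u2)) ?_
    simp only [recipVarJet]; push_cast; simp; ring
  · refine HasDerivAt.congr_deriv (v0.mul (hp 2)) ?_
    simp only [ratioVar]; push_cast; simp; ring
  · refine HasDerivAt.congr_deriv ((v1.mul (hp 2)).sub (((v0.const_mul 2).mul (hp 3)).mul u1)) ?_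
    simp only [ratioVarJet]; push_cast; simp; ring
  · refine HasDerivAt.congr_deriv ((((v2.mul (hp 2)).sub (((v1.const_mul 4).mul (hp 3)).mul u1)).add
      (((v0.const_mul 6).mul (hp 4)).mul (u1.pow 2))).sub
      (((v0.const_mul 2).mul (hp 3)).mul u2)) ?_
    simp only [ratioVarJet]; push_cast; simp; ring

lemma contDiff_add_smul (hu : ContDiff ℝ ∞ u) (hw : ContDiff ℝ ∞ w) (ε : ℝ) :
    ContDiff ℝ ∞ (u + ε • w) := hu.add (contDiff_const.smul hw)

lemma eventually_variation_ne (h0 : u x 0 ≠ 0) :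
    ∀ᶠ ε : ℝ in 𝓝 0, (u + ε • w) x 0 ≠ 0 := by
  have : Continuous fun ε : ℝ => u x 0 + ε * w x 0 := by fun_prop
  exact this.continuousAt.eventually_ne (by simpa using h0)

lemma coeffDeriv_thirdOrderOp_zero (hu : ContDiff ℝ ∞ u) (hw : ContDiff ℝ ∞ w)
    (hχ : ContDiff ℝ ∞ χ) (h0 : u x 0 ≠ 0) :
    coeffDeriv thirdOrderOp u w χ x 0 = recipVarJet u w 2 x * jet χ 1 1 x
      + 2 * recipVarJet u w 1 x * jet χ 2 1 x + recipVar u w x * jet χ 3 1 x := by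
  obtain ⟨a0, a1, a2, -⟩ := hasDerivAt_variation hu hw h0
  have h : (fun ε : ℝ => thirdOrderOp (u + ε • w) χ x 0) =ᶠ[𝓝 0] fun ε : ℝ =>
      recipJet (u + ε • w) 2 x * jet χ 1 1 x + 2 * recipJet (u + ε • w) 1 x * jet χ 2 1 x
      + recipJet (u + ε • w) 0 x * jet χ 3 1 x :=
    (eventually_variation_ne h0).mono fun ε hε =>
      thirdOrderOp_apply_zero (contDiff_add_smul hu hw ε) hχ hε
  rw [coeffDeriv, h.deriv_eq]
  exact (((a2.mul_const _).add ((a1.const_mul 2).mul_const _)).add (a0.mul_const _)).deriv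

lemma coeffDeriv_thirdOrderOp_one (hu : ContDiff ℝ ∞ u) (hw : ContDiff ℝ ∞ w)
    (hχ : ContDiff ℝ ∞ χ) (h0 : u x 0 ≠ 0) :
    coeffDeriv thirdOrderOp u w χ x 1 = recipVarJet u w 1 x * jet χ 2 0 x
      + recipVar u w x * jet χ 3 0 x + ratioVarJet u w 2 x * jet χ 1 1 x
      + 3 * ratioVarJet u w 1 x * jet χ 2 1 x + 2 * ratioVar u w x * jet χ 3 1 x := by
  obtain ⟨a0, a1, -, b0, b1, b2⟩ := hasDerivAt_variation hu hw h0
  have h : (fun ε : ℝ => thirdOrderOp (u + ε • w) χ x 1) =ᶠ[𝓝 0] fun ε : ℝ =>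
      recipJet (u + ε • w) 1 x * jet χ 2 0 x + recipJet (u + ε • w) 0 x * jet χ 3 0 x
      + ratioJet (u + ε • w) 2 x * jet χ 1 1 x + 3 * ratioJet (u + ε • w) 1 x * jet χ 2 1 x
      + 2 * ratioJet (u + ε • w) 0 x * jet χ 3 1 x :=
    (eventually_variation_ne h0).mono fun ε hε =>
      thirdOrderOp_apply_one (contDiff_add_smul hu hw ε) hχ hε
  rw [coeffDeriv, h.deriv_eq]
  exact (((((a1.mul_const _).add (a0.mul_const _)).add (b2.mul_const _)).add
    ((b1.const_mul 3).mul_const _)).add ((b0.const_mul 2).mul_const _)).deriv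

lemma coeffDeriv_firstOrderOp {U : Set Pt} (hU : IsOpen U) {g : Pt → Fin 2 → Fin 2 → ℝ}
    {Γ : Pt → Fin 2 → Fin 2 → Fin 2 → ℝ} (hg : SmoothMetric U g) (hΓ : SmoothSymbols U Γ)
    (hu : IsFieldIn U u) (hw : ContDiff ℝ ∞ w) (i : Fin 2) :
    coeffDeriv (firstOrderOp g Γ) u w χ x i =
      ∑ j, ((∑ k, partialD k (fun v => g v i j) (u x) * w x k) * jet χ 1 j x
        + (∑ k, ((∑ l, partialD l (fun v => Γ v i j k) (u x) * w x l) * jet u 1 k x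
          + Γ (u x) i j k * jet w 1 k x)) * χ x j) := by
  have hl : ∀ c d : ℝ, HasDerivAt (fun ε : ℝ => c + ε * d) d 0 := fun c d => by
    simpa using ((hasDerivAt_id (0 : ℝ)).mul_const d).const_add c
  have e : ∀ ε : ℝ, (u + ε • w) x = u x + ε • w x := fun ε => rfl
  simp only [coeffDeriv, firstOrderOp_apply, jet_add_smul hu.1 hw, e]
  refine (HasDerivAt.fun_sum fun j _ =>
    ((hasDerivAt_line (differentiableAt_of_smooth hU (hg i j) (hu.2 x))).mul_const _).add
    ((HasDerivAt.fun_sum fun k _ =>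
      (hasDerivAt_line (differentiableAt_of_smooth hU (hΓ i j k) (hu.2 x))).mul
        (hl (jet u 1 k x) (jet w 1 k x))).mul_const _)).deriv.trans ?_
  simp

end

/-! ### Reduction of the Schouten bracket by integration by parts -/

section
variable {u w φ ψ χ : Field1} {U : Set Pt} {g : Pt → Fin 2 → Fin 2 → ℝ}
  {Γ : Pt → Fin 2 → Fin 2 → Fin 2 → ℝ}

lemma continuous_component (hφ : ContDiff ℝ ∞ φ) (i : Fin 2) : Continuous fun x => φ x i :=
  (contDiff_component hφ i).continuous

lemma contDiff_recipJet (hu : ContDiff ℝ ∞ u) (h0 : ∀ x, u x 0 ≠ 0) (n : ℕ) :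
    ContDiff ℝ ∞ (recipJet u n) := by
  have ha : ContDiff ℝ ∞ fun x => (u x 0)⁻¹ := (contDiff_component hu 0).inv h0
  have hj := contDiff_jet hu
  match n with
  | 0 => exact ha
  | 1 => exact (ha.pow 2).neg.mul (hj 1 0)
  | (n + 2) =>
    exact ((contDiff_const.mul (ha.pow 3)).mul ((hj 1 0).pow 2)).sub ((ha.pow 2).mul (hj 2 0))

lemma contDiff_ratioJet (hu : ContDiff ℝ ∞ u) (h0 : ∀ x, u x 0 ≠ 0) (n : ℕ) :
    ContDiff ℝ ∞ (ratioJet u n) := by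
  have ha : ContDiff ℝ ∞ fun x => (u x 0)⁻¹ := (contDiff_component hu 0).inv h0
  have hj := contDiff_jet hu
  have hv := contDiff_component hu 1
  match n with
  | 0 => exact hv.mul (ha.pow 2)
  | 1 =>
    exact ((hj 1 1).mul (ha.pow 2)).sub
      (((contDiff_const.mul hv).mul (ha.pow 3)).mul (hj 1 0))
  | (n + 2) =>
    exact ((((hj 2 1).mul (ha.pow 2)).sub
      (((contDiff_const.mul (hj 1 1)).mul (ha.pow 3)).mul (hj 1 0))).add
      (((contDiff_const.mul hv).mul (ha.pow 4)).mul ((hj 1 0).pow 2))).sub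
      (((contDiff_const.mul hv).mul (ha.pow 3)).mul (hj 2 0))

lemma contDiff_thirdOrderOp (hu : ContDiff ℝ ∞ u) (h0 : ∀ x, u x 0 ≠ 0)
    (hψ : ContDiff ℝ ∞ ψ) : ContDiff ℝ ∞ (thirdOrderOp u ψ) := by
  have hj := contDiff_jet hψ
  have ha := contDiff_recipJet hu h0
  have hb := contDiff_ratioJet hu h0
  refine contDiff_pi.2 fun i => ?_
  match i with
  | 0 =>
    rw [funext fun x => thirdOrderOp_apply_zero hu hψ (h0 x)]
    exact (((ha 2).mul (hj 1 1)).add ((contDiff_const.mul (ha 1)).mul (hj 2 1))).add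
      ((ha 0).mul (hj 3 1))
  | 1 =>
    rw [funext fun x => thirdOrderOp_apply_one hu hψ (h0 x)]
    exact (((((ha 1).mul (hj 2 0)).add ((ha 0).mul (hj 3 0))).add ((hb 2).mul (hj 1 1))).add
      ((contDiff_const.mul (hb 1)).mul (hj 2 1))).add
      ((contDiff_const.mul (hb 0)).mul (hj 3 1))

lemma contDiff_firstOrderOp (hU : IsOpen U) (hg : SmoothMetric U g) (hΓ : SmoothSymbols U Γ)
    (hu : IsFieldIn U u) (hψ : ContDiff ℝ ∞ ψ) : ContDiff ℝ ∞ (firstOrderOp g Γ u ψ) := by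
  refine contDiff_pi.2 fun i => ?_
  rw [funext fun x => firstOrderOp_apply g Γ u ψ x i]
  exact ContDiff.sum fun j _ => ((contDiff_along hU (hg i j) hu).mul (contDiff_jet hψ 1 j)).add
    ((ContDiff.sum fun k _ => (contDiff_along hU (hΓ i j k) hu).mul (contDiff_jet hu.1 1 k)).mul
      (contDiff_component hψ j))

/-- The density `Nᵏ(φ, χ)` for which `∫ ⟨φ, (D R [w]) χ⟩ dx = ∫ Nᵏ wᵏ dx`, where `R` is the
third-order operator. -/
def thirdForm (u φ χ : Field1) (x : ℝ) : Pt :=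
  ![(u x 0)⁻¹ ^ 2 * (jet φ 1 1 x * jet χ 2 0 x - jet φ 2 0 x * jet χ 1 1 x)
      + 2 * u x 1 * (u x 0)⁻¹ ^ 3 * (jet φ 1 1 x * jet χ 2 1 x - jet φ 2 1 x * jet χ 1 1 x),
    -(u x 0)⁻¹ ^ 2 * (jet φ 1 1 x * jet χ 2 1 x - jet φ 2 1 x * jet χ 1 1 x)]

/-- The density `Mᵏ(φ, χ)` for which `∫ ⟨φ, (D P [w]) χ⟩ dx = ∫ Mᵏ wᵏ dx`, where `P` is a
skew-adjoint first-order operator with symbols `Γ`. -/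
def firstForm (Γ : Pt → Fin 2 → Fin 2 → Fin 2 → ℝ) (u φ χ : Field1) (x : ℝ) : Pt :=
  fun k => ∑ i, ∑ j, (Γ (u x) j i k * φ x i * jet χ 1 j x - Γ (u x) i j k * jet φ 1 i x * χ x j
    + (∑ l, (partialD k (fun v => Γ v i j l) (u x) - partialD l (fun v => Γ v i j k) (u x))
        * jet u 1 l x) * φ x i * χ x j)

/-- The pointwise conditions on the coefficients that express skew-adjointness. -/
def SkewCoeffs (U : Set Pt) (g : Pt → Fin 2 → Fin 2 → ℝ)
    (Γ : Pt → Fin 2 → Fin 2 → Fin 2 → ℝ) : Prop :=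
  (∀ v ∈ U, ∀ i j, g v i j = g v j i) ∧
  ∀ v ∈ U, ∀ i j k, partialD k (fun w => g w i j) v = Γ v i j k + Γ v j i k

lemma continuous_thirdForm (hu : ContDiff ℝ ∞ u) (h0 : ∀ x, u x 0 ≠ 0) (hφ : ContDiff ℝ ∞ φ)
    (hχ : ContDiff ℝ ∞ χ) (k : Fin 2) : Continuous fun x => thirdForm u φ χ x k := by
  have ha : Continuous fun x => (u x 0)⁻¹ := (continuous_component hu 0).inv₀ h0
  have hv := continuous_component hu 1
  have hp := continuous_jet hφ
  have hq := continuous_jet hχ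
  match k with
  | 0 =>
    exact ((ha.pow 2).mul (((hp 1 1).mul (hq 2 0)).sub ((hp 2 0).mul (hq 1 1)))).add
      (((continuous_const.mul hv).mul (ha.pow 3)).mul
        (((hp 1 1).mul (hq 2 1)).sub ((hp 2 1).mul (hq 1 1))))
  | 1 => exact (ha.pow 2).neg.mul (((hp 1 1).mul (hq 2 1)).sub ((hp 2 1).mul (hq 1 1)))

lemma continuous_firstForm (hU : IsOpen U) (hΓ : SmoothSymbols U Γ) (hu : IsFieldIn U u)
    (hφ : ContDiff ℝ ∞ φ) (hχ : ContDiff ℝ ∞ χ) (k : Fin 2) :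
    Continuous fun x => firstForm Γ u φ χ x k := by
  have hu1 := hu.1
  have h1 : ∀ i j k, Continuous fun x => Γ (u x) i j k := fun i j k =>
    (contDiff_along hU (hΓ i j k) hu).continuous
  have h2 : ∀ i j k l, Continuous fun x => partialD l (fun v => Γ v i j k) (u x) :=
    fun i j k l => (contDiff_along hU (contDiffOn_partialD hU (hΓ i j k) l) hu).continuous
  unfold firstForm
  refine continuous_finsetSum _ fun i _ => continuous_finsetSum _ fun j _ => ?_
  have h3 : ∀ l, Continuous fun x => (partialD k (fun v => Γ v i j l) (u x)
      - partialD l (fun v => Γ v i j k) (u x)) * jet u 1 l x := fun l =>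
    ((h2 i j l k).sub (h2 i j k l)).mul (continuous_jet hu1 1 l)
  exact ((((h1 j i k).mul (continuous_component hφ i)).mul (continuous_jet hχ 1 j)).sub
    (((h1 i j k).mul (continuous_jet hφ 1 i)).mul (continuous_component hχ j))).add
    (((continuous_finsetSum _ fun l _ => h3 l).mul (continuous_component hφ i)).mul
      (continuous_component hχ j))

lemma pairing_coeffDeriv_thirdOrderOp (hu : ContDiff ℝ ∞ u) (h0 : ∀ x, u x 0 ≠ 0)
    (hφ : IsTest φ) (hχ : ContDiff ℝ ∞ χ) (hw : ContDiff ℝ ∞ w) :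
    pairing φ (coeffDeriv thirdOrderOp u w χ) = ∫ x, ∑ k, thirdForm u φ χ x k * w x k := by
  obtain ⟨hφ, hc⟩ := hφ
  simp only [pairing, Fin.sum_univ_two, coeffDeriv_thirdOrderOp_zero hu hw hχ (h0 _),
    coeffDeriv_thirdOrderOp_one hu hw hχ (h0 _)]
  refine integral_eq_of_hasDerivAt (K := tsupport φ)
    (S := fun x => φ x 0 * (recipVarJet u w 1 x * jet χ 1 1 x + recipVar u w x * jet χ 2 1 x)
      - jet φ 1 0 x * (recipVar u w x * jet χ 1 1 x)
      + φ x 1 * (recipVar u w x * jet χ 2 0 x + 2 * (ratioVar u w x * jet χ 2 1 x)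
        + ratioVarJet u w 1 x * jet χ 1 1 x)
      - jet φ 1 1 x * (ratioVar u w x * jet χ 1 1 x)) hc ?_ ?_ ?_ ?_ ?_ ?_
  · have ha : Continuous (recipJet u 0) := (contDiff_recipJet hu h0 0).continuous
    have ea : ∀ x, (u x 0)⁻¹ = recipJet u 0 x := fun x => rfl
    have eu : ∀ x, u x 1 = jet u 0 1 x := fun x => (congrFun (jet_zero u 1) x).symm
    have ew : ∀ x i, w x i = jet w 0 i x := fun x i => (congrFun (jet_zero w i) x).symm
    have ep : ∀ x i, φ x i = jet φ 0 i x := fun x i => (congrFun (jet_zero φ i) x).symm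
    have cu := continuous_jet hu
    have cw := continuous_jet hw
    have cp := continuous_jet hφ
    have cq := continuous_jet hχ
    simp only [recipVarJet, ratioVarJet, recipVar, ratioVar, ea, eu, ew, ep]
    generalize recipJet u 0 = a at ha
    generalize jet u = u at cu
    generalize jet w = w at cw
    generalize jet φ = p at cp
    generalize jet χ = q at cq
    fun_prop
  · exact ((continuous_thirdForm hu h0 hφ hχ 0).mul (continuous_component hw 0)).add
      ((continuous_thirdForm hu h0 hφ hχ 1).mul (continuous_component hw 1))
  · intro x hx; simp [apply_eq_zero hx]
  · intro x hx; simp [thirdForm, jet_eq_zero hx]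
  · intro x hx; simp [apply_eq_zero hx, jet_eq_zero hx]
  · intro x
    have ha := hasDerivAt_recipVar hu hw (h0 x)
    have ha1 := hasDerivAt_recipVarJet hu hw (h0 x)
    have hb := hasDerivAt_ratioVar hu hw (h0 x)
    have hb1 := hasDerivAt_ratioVarJet hu hw (h0 x)
    have hφ0 := fun i => hasDerivAt_component hφ i x
    have hφ1 := fun i => hasDerivAt_jet hφ 1 i x
    have hχ1 := hasDerivAt_jet hχ 1 1 x
    have hχ2 := fun i => hasDerivAt_jet hχ 2 i x
    refine HasDerivAt.congr_deriv (((((hφ0 0).mul ((ha1.mul hχ1).add (ha.mul (hχ2 1)))).sub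
      ((hφ1 0).mul (ha.mul hχ1))).add ((hφ0 1).mul (((ha.mul (hχ2 0)).add
      ((hb.mul (hχ2 1)).const_mul 2)).add (hb1.mul hχ1)))).sub ((hφ1 1).mul (hb.mul hχ1))) ?_
    simp only [thirdForm, Matrix.cons_val_zero, Matrix.cons_val_one, Matrix.cons_val_fin_one,
      Pi.add_apply, Pi.mul_apply]
    simp only [recipVar, ratioVar]
    ring

lemma pairing_coeffDeriv_firstOrderOp (hU : IsOpen U) (hg : SmoothMetric U g)
    (hΓ : SmoothSymbols U Γ) (hs : SkewCoeffs U g Γ) (hu : IsFieldIn U u)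
    (hφ : IsTest φ) (hχ : ContDiff ℝ ∞ χ) (hw : ContDiff ℝ ∞ w) :
    pairing φ (coeffDeriv (firstOrderOp g Γ) u w χ)
      = ∫ x, ∑ k, firstForm Γ u φ χ x k * w x k := by
  obtain ⟨hφ, hc⟩ := hφ
  have hu1 := hu.1
  have c1 : ∀ i j k, Continuous fun x => Γ (u x) i j k := fun i j k =>
    (contDiff_along hU (hΓ i j k) hu).continuous
  have c2 : ∀ i j k l, Continuous fun x => partialD l (fun v => Γ v i j k) (u x) :=
    fun i j k l => (contDiff_along hU (contDiffOn_partialD hU (hΓ i j k) l) hu).continuous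
  simp only [pairing, coeffDeriv_firstOrderOp hU hg hΓ hu hw, hs.2 _ (hu.2 _)]
  refine integral_eq_of_hasDerivAt (K := tsupport φ)
    (S := fun x => ∑ i, ∑ j, ∑ k, Γ (u x) i j k * (w x k * (φ x i * χ x j))) hc ?_ ?_ ?_ ?_ ?_ ?_
  · refine continuous_finsetSum _ fun i _ => (continuous_component hφ i).mul
      (continuous_finsetSum _ fun j _ => ?_)
    refine ((continuous_finsetSum _ fun k _ => ?_).mul (continuous_jet hχ 1 j)).add
      ((continuous_finsetSum _ fun k _ => (((continuous_finsetSum _ fun l _ => ?_).mul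
        (continuous_jet hu1 1 k)).add ((c1 i j k).mul (continuous_jet hw 1 k)))).mul
        (continuous_component hχ j))
    · exact ((c1 i j k).add (c1 j i k)).mul (continuous_component hw k)
    · exact (c2 i j k l).mul (continuous_component hw l)
  · exact continuous_finsetSum _ fun k _ => (continuous_firstForm hU hΓ hu hφ hχ k).mul
      (continuous_component hw k)
  · intro x hx; simp [apply_eq_zero hx]
  · intro x hx; simp [firstForm, apply_eq_zero hx, jet_eq_zero hx]
  · intro x hx; simp [apply_eq_zero hx]
  · intro x
    refine HasDerivAt.congr_deriv (HasDerivAt.fun_sum fun i _ => HasDerivAt.fun_sum fun j _ =>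
      HasDerivAt.fun_sum fun k _ => (hasDerivAt_along hU (hΓ i j k) hu x).mul
        ((hasDerivAt_component hw k x).mul ((hasDerivAt_component hφ i x).mul
          (hasDerivAt_component hχ j x)))) ?_
    simp only [firstForm, Fin.sum_univ_two]
    ring

lemma integrable_form_mul (hφ : IsTest φ) {N : ℝ → Pt} (hN : ∀ k, Continuous fun x => N x k)
    (hN0 : ∀ x ∉ tsupport φ, ∀ k, N x k = 0) (hw : ContDiff ℝ ∞ w) :
    Integrable fun x => ∑ k, N x k * w x k :=
  (continuous_finsetSum _ fun k _ => (hN k).mul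
    (continuous_component hw k)).integrable_of_hasCompactSupport
    (HasCompactSupport.intro hφ.2 fun x hx => by simp [hN0 x hx])

lemma integrable_thirdForm (hu : ContDiff ℝ ∞ u) (h0 : ∀ x, u x 0 ≠ 0) (hφ : IsTest φ)
    (hχ : ContDiff ℝ ∞ χ) (hw : ContDiff ℝ ∞ w) :
    Integrable fun x => ∑ k, thirdForm u φ χ x k * w x k :=
  integrable_form_mul hφ (continuous_thirdForm hu h0 hφ.1 hχ)
    (fun x hx k => by fin_cases k <;> simp [thirdForm, jet_eq_zero hx]) hw

lemma integrable_firstForm (hU : IsOpen U) (hΓ : SmoothSymbols U Γ) (hu : IsFieldIn U u)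
    (hφ : IsTest φ) (hχ : ContDiff ℝ ∞ χ) (hw : ContDiff ℝ ∞ w) :
    Integrable fun x => ∑ k, firstForm Γ u φ χ x k * w x k :=
  integrable_form_mul hφ (continuous_firstForm hU hΓ hu hφ.1 hχ)
    (fun x hx k => by simp [firstForm, apply_eq_zero hx, jet_eq_zero hx]) hw

lemma integral_add_add {F G H : ℝ → ℝ} (hF : Integrable F) (hG : Integrable G)
    (hH : Integrable H) : ∫ x, (F x + G x + H x) = (∫ x, F x) + (∫ x, G x) + ∫ x, H x :=
  (integral_add (hF.add hG) hH).trans (congrArg (· + _) (integral_add hF hG))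

/-- The density of `[P, R]` in one of the three cyclic positions. -/
def mixedDensity (g : Pt → Fin 2 → Fin 2 → ℝ) (Γ : Pt → Fin 2 → Fin 2 → Fin 2 → ℝ)
    (u φ ψ χ : Field1) (x : ℝ) : ℝ :=
  ∑ k, thirdForm u φ χ x k * firstOrderOp g Γ u ψ x k
    + ∑ k, firstForm Γ u φ χ x k * thirdOrderOp u ψ x k

/-- The density of `[P, P]` (up to the factor `2`) in one of the three cyclic positions. -/
def firstDensity (g : Pt → Fin 2 → Fin 2 → ℝ) (Γ : Pt → Fin 2 → Fin 2 → Fin 2 → ℝ)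
    (u φ ψ χ : Field1) (x : ℝ) : ℝ :=
  ∑ k, firstForm Γ u φ χ x k * firstOrderOp g Γ u ψ x k

lemma integrable_mixedDensity (hU : IsOpen U) (hU0 : ∀ v ∈ U, v 0 ≠ 0)
    (hg : SmoothMetric U g) (hΓ : SmoothSymbols U Γ) (hu : IsFieldIn U u)
    (hφ : IsTest φ) (hψ : IsTest ψ) (hχ : IsTest χ) :
    Integrable (mixedDensity g Γ u φ ψ χ) :=
  (integrable_thirdForm hu.1 (fun x => hU0 _ (hu.2 x)) hφ hχ.1
    (contDiff_firstOrderOp hU hg hΓ hu hψ.1)).add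
  (integrable_firstForm hU hΓ hu hφ hχ.1
    (contDiff_thirdOrderOp hu.1 (fun x => hU0 _ (hu.2 x)) hψ.1))

/-- The bracket `[P, R]` as the integral of a cyclic sum of densities. -/
lemma schouten_first_third (hU : IsOpen U) (hU0 : ∀ v ∈ U, v 0 ≠ 0)
    (hg : SmoothMetric U g) (hΓ : SmoothSymbols U Γ) (hs : SkewCoeffs U g Γ)
    (hu : IsFieldIn U u) (hφ : IsTest φ) (hψ : IsTest ψ) (hχ : IsTest χ) :
    schouten (firstOrderOp g Γ) thirdOrderOp u φ ψ χ =
      ∫ x, (mixedDensity g Γ u φ ψ χ x + mixedDensity g Γ u ψ χ φ x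
        + mixedDensity g Γ u χ φ ψ x) := by
  have h0 : ∀ x, u x 0 ≠ 0 := fun x => hU0 _ (hu.2 x)
  have sR : ∀ {η : Field1}, IsTest η → ContDiff ℝ ∞ (thirdOrderOp u η) := fun h =>
    contDiff_thirdOrderOp hu.1 h0 h.1
  have sP : ∀ {η : Field1}, IsTest η → ContDiff ℝ ∞ (firstOrderOp g Γ u η) := fun h =>
    contDiff_firstOrderOp hU hg hΓ hu h.1
  rw [integral_add_add (integrable_mixedDensity hU hU0 hg hΓ hu hφ hψ hχ)
    (integrable_mixedDensity hU hU0 hg hΓ hu hψ hχ hφ)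
    (integrable_mixedDensity hU hU0 hg hΓ hu hχ hφ hψ)]
  have key : ∀ {a b c : Field1}, IsTest a → IsTest b → IsTest c →
      ∫ x, mixedDensity g Γ u a b c x = pairing a (coeffDeriv thirdOrderOp u
        (firstOrderOp g Γ u b) c) + pairing a (coeffDeriv (firstOrderOp g Γ) u
        (thirdOrderOp u b) c) := fun ha hb hc => by
    rw [pairing_coeffDeriv_thirdOrderOp hu.1 h0 ha hc.1 (sP hb),
      pairing_coeffDeriv_firstOrderOp hU hg hΓ hs hu ha hc.1 (sR hb)]
    exact integral_add (integrable_thirdForm hu.1 h0 ha hc.1 (sP hb))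
      (integrable_firstForm hU hΓ hu ha hc.1 (sR hb))
  rw [key hφ hψ hχ, key hψ hχ hφ, key hχ hφ hψ, schouten, cyclicSum, cyclicSum]
  ring

/-- The bracket `[P, P]` as the integral of a cyclic sum of densities; the two cyclic sums in the
definition of the bracket coincide, whence the factor `2`. -/
lemma schouten_first_first (hU : IsOpen U)
    (hg : SmoothMetric U g) (hΓ : SmoothSymbols U Γ) (hs : SkewCoeffs U g Γ)
    (hu : IsFieldIn U u) (hφ : IsTest φ) (hψ : IsTest ψ) (hχ : IsTest χ) :
    schouten (firstOrderOp g Γ) (firstOrderOp g Γ) u φ ψ χ =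
      2 * ∫ x, (firstDensity g Γ u φ ψ χ x + firstDensity g Γ u ψ χ φ x
        + firstDensity g Γ u χ φ ψ x) := by
  have sP : ∀ {η : Field1}, IsTest η → ContDiff ℝ ∞ (firstOrderOp g Γ u η) := fun h =>
    contDiff_firstOrderOp hU hg hΓ hu h.1
  have int : ∀ {a b c : Field1}, IsTest a → IsTest b → IsTest c →
      Integrable (firstDensity g Γ u a b c) := fun ha hb hc =>
    integrable_firstForm hU hΓ hu ha hc.1 (sP hb)
  have key : ∀ {a b c : Field1}, IsTest a → IsTest b → IsTest c →
      pairing a (coeffDeriv (firstOrderOp g Γ) u (firstOrderOp g Γ u b) c)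
        = ∫ x, firstDensity g Γ u a b c x := fun ha hb hc =>
    pairing_coeffDeriv_firstOrderOp hU hg hΓ hs hu ha hc.1 (sP hb)
  rw [integral_add_add (int hφ hψ hχ) (int hψ hχ hφ) (int hχ hφ hψ), schouten, cyclicSum,
    key hφ hψ hχ, key hψ hχ hφ, key hχ hφ hψ]
  ring

end

/-! ### Sufficiency of the rational form -/

section
variable {u φ ψ χ : Field1} {U : Set Pt} {g : Pt → Fin 2 → Fin 2 → ℝ}
  {Γ : Pt → Fin 2 → Fin 2 → Fin 2 → ℝ}

lemma firstOrderOp_eq_zero {x : ℝ} (hx : x ∉ tsupport ψ) (i : Fin 2) :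
    firstOrderOp g Γ u ψ x i = 0 := by
  simp [firstOrderOp_apply, apply_eq_zero hx, jet_eq_zero hx]

lemma isSkewAdjoint_of_skewCoeffs (hU : IsOpen U) (hg : SmoothMetric U g)
    (hΓ : SmoothSymbols U Γ) (hs : SkewCoeffs U g Γ) : IsSkewAdjoint U (firstOrderOp g Γ) := by
  rintro u φ ψ hu ⟨hφ, hc⟩ ⟨hψ, -⟩
  have sφ := contDiff_firstOrderOp hU hg hΓ hu hφ
  have sψ := contDiff_firstOrderOp hU hg hΓ hu hψ
  rw [pairing, pairing, ← integral_neg]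
  refine integral_eq_of_hasDerivAt (K := tsupport φ)
    (S := fun x => ∑ i, ∑ j, g (u x) i j * (φ x i * ψ x j)) hc ?_ ?_ ?_ ?_ ?_ ?_
  · exact continuous_finsetSum _ fun i _ => (continuous_component hφ i).mul
      (continuous_component sψ i)
  · exact (continuous_finsetSum _ fun i _ => (continuous_component hψ i).mul
      (continuous_component sφ i)).neg
  · intro x hx; simp [apply_eq_zero hx]
  · intro x hx; simp [firstOrderOp_eq_zero hx]
  · intro x hx; simp [apply_eq_zero hx]
  · intro x
    refine HasDerivAt.congr_deriv (HasDerivAt.fun_sum fun i _ => HasDerivAt.fun_sum fun j _ =>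
      (hasDerivAt_along hU (hg i j) hu x).mul ((hasDerivAt_component hφ i x).mul
          (hasDerivAt_component hψ j x))) ?_
    simp only [hs.2 _ (hu.2 x), firstOrderOp_apply, Fin.sum_univ_two, hs.1 _ (hu.2 x) 1 0]
    ring

/-- The algebraic conditions on curl-free symbols under which the density of `[P, P]` vanishes
identically: symmetry of `Γʲⁱₖ gᵏᵐ` in `j, m` and of `Γʲⁱₖ Γᵏᵐₗ` in `i, m`. -/
lemma sum_firstDensity_eq_zero {x : ℝ}
    (hcurl : ∀ i j k l,
      partialD k (fun v => Γ v i j l) (u x) = partialD l (fun v => Γ v i j k) (u x))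
    (hgΓ : ∀ i, ∑ k, Γ (u x) 0 i k * g (u x) k 1 = ∑ k, Γ (u x) 1 i k * g (u x) k 0)
    (hΓΓ : ∀ j l, ∑ k, Γ (u x) j 0 k * Γ (u x) k 1 l = ∑ k, Γ (u x) j 1 k * Γ (u x) k 0 l) :
    firstDensity g Γ u φ ψ χ x + firstDensity g Γ u ψ χ φ x + firstDensity g Γ u χ φ ψ x = 0 := by
  have h0 := hgΓ 0
  have h1 := hgΓ 1
  have q00 := hΓΓ 0 0
  have q01 := hΓΓ 0 1
  have q10 := hΓΓ 1 0
  have q11 := hΓΓ 1 1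
  simp only [firstDensity, firstForm, firstOrderOp_apply, hcurl _ _ 0 1, Fin.sum_univ_two]
    at h0 h1 q00 q01 q10 q11 ⊢
  generalize Γ (u x) = G at *
  generalize g (u x) = g at *
  linear_combination
    (φ x 0 * (jet χ 1 0 x * jet ψ 1 1 x - jet χ 1 1 x * jet ψ 1 0 x)
      + ψ x 0 * (jet φ 1 0 x * jet χ 1 1 x - jet φ 1 1 x * jet χ 1 0 x)
      + χ x 0 * (jet ψ 1 0 x * jet φ 1 1 x - jet ψ 1 1 x * jet φ 1 0 x)) * h0
    + (φ x 1 * (jet χ 1 0 x * jet ψ 1 1 x - jet χ 1 1 x * jet ψ 1 0 x)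
      + ψ x 1 * (jet φ 1 0 x * jet χ 1 1 x - jet φ 1 1 x * jet χ 1 0 x)
      + χ x 1 * (jet ψ 1 0 x * jet φ 1 1 x - jet ψ 1 1 x * jet φ 1 0 x)) * h1
    + ((φ x 0 * ψ x 1 - φ x 1 * ψ x 0) * jet χ 1 0 x + (ψ x 0 * χ x 1 - ψ x 1 * χ x 0) * jet φ 1 0 x
      + (χ x 0 * φ x 1 - χ x 1 * φ x 0) * jet ψ 1 0 x) * (jet u 1 0 x * q00 + jet u 1 1 x * q01)
    + ((φ x 0 * ψ x 1 - φ x 1 * ψ x 0) * jet χ 1 1 x + (ψ x 0 * χ x 1 - ψ x 1 * χ x 0) * jet φ 1 1 x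
      + (χ x 0 * φ x 1 - χ x 1 * φ x 0) * jet ψ 1 1 x) * (jet u 1 0 x * q10 + jet u 1 1 x * q11)

/-- The symbols that belong to the metric with constants `c₁, …, c₆`; the constant `c₅` does not
enter. -/
def rationalSymbols (c₁ c₂ c₃ c₄ c₆ : ℝ) (v : Pt) (i j k : Fin 2) : ℝ :=
  ![![![c₁ / 2, c₂ / 2], ![c₄, -c₁ / 2]],
    ![![-(c₃ + c₂ / 2 * v 1 ^ 2) * (v 0)⁻¹ ^ 2, c₂ * v 1 * (v 0)⁻¹ + c₁ / 2],
      ![(c₁ * v 1 ^ 2 - c₆) / 2 * (v 0)⁻¹ ^ 2, c₄ - c₁ * v 1 * (v 0)⁻¹]]] i j k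

/-- The part of the flux of `[P, R]` that is bilinear and skew in `φ, χ` and carries the constants
`c₁` (with `ψ₁`) and `c₄` (with `ψ₂`). -/
def fluxY (u φ χ : Field1) (x : ℝ) : ℝ :=
  (u x 0)⁻¹ * (jet φ 1 0 x * jet χ 2 1 x - jet φ 2 1 x * jet χ 1 0 x
      + (jet φ 1 1 x * jet χ 2 0 x - jet φ 2 0 x * jet χ 1 1 x))
    - (u x 0)⁻¹ ^ 2 * jet u 1 0 x * (jet φ 1 0 x * jet χ 1 1 x - jet φ 1 1 x * jet χ 1 0 x)
    + 2 * u x 1 * (u x 0)⁻¹ ^ 2 * (jet φ 1 1 x * jet χ 2 1 x - jet φ 2 1 x * jet χ 1 1 x)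

/-- The part of the flux of `[P, R]` that is bilinear and skew in `φ, χ` and carries the constants
`c₂` (with `ψ₁`) and `c₁` (with `ψ₂`). -/
def fluxZ (u φ χ : Field1) (x : ℝ) : ℝ :=
  1 / 2 * (u x 0)⁻¹ * (jet φ 1 0 x * jet χ 2 0 x - jet φ 2 0 x * jet χ 1 0 x)
    + (1 / 2 * (u x 0)⁻¹ ^ 2 * jet u 1 1 x - (u x 0)⁻¹ ^ 3 * jet u 1 0 x * u x 1)
      * (jet φ 1 0 x * jet χ 1 1 x - jet φ 1 1 x * jet χ 1 0 x)
    + u x 1 * (u x 0)⁻¹ ^ 2 * (jet φ 1 0 x * jet χ 2 1 x - jet φ 2 1 x * jet χ 1 0 x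
      + (jet φ 1 1 x * jet χ 2 0 x - jet φ 2 0 x * jet χ 1 1 x))
    + 3 / 2 * u x 1 ^ 2 * (u x 0)⁻¹ ^ 3 * (jet φ 1 1 x * jet χ 2 1 x - jet φ 2 1 x * jet χ 1 1 x)

/-- The part of the flux of `[P, R]` that is bilinear and skew in `φ, χ` and carries the constants
`c₃` (with `ψ₁`) and `c₆` (with `ψ₂`). -/
def fluxB (u φ χ : Field1) (x : ℝ) : ℝ :=
  (u x 0)⁻¹ ^ 3 * (jet φ 1 1 x * jet χ 2 1 x - jet φ 2 1 x * jet χ 1 1 x)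

/-- The flux whose cyclic sum has the density of `[P, R]` as its derivative, for the first-order
operator of rational form. -/
def flux (c₁ c₂ c₃ c₄ c₆ : ℝ) (u φ ψ χ : Field1) (x : ℝ) : ℝ :=
  ψ x 0 * (c₁ / 2 * fluxY u φ χ x + c₂ * fluxZ u φ χ x - c₃ * fluxB u φ χ x)
    + ψ x 1 * (-c₁ * fluxZ u φ χ x + c₄ * fluxY u φ χ x - c₆ / 2 * fluxB u φ χ x)

/-- The derivative of `fluxY`. -/
def fluxY' (u φ χ : Field1) (x : ℝ) : ℝ :=
  (u x 0)⁻¹ * (jet φ 1 0 x * jet χ 3 1 x - jet φ 3 1 x * jet χ 1 0 x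
      + (jet φ 1 1 x * jet χ 3 0 x - jet φ 3 0 x * jet χ 1 1 x))
    + (2 * (u x 0)⁻¹ ^ 3 * jet u 1 0 x ^ 2 - (u x 0)⁻¹ ^ 2 * jet u 2 0 x)
      * (jet φ 1 0 x * jet χ 1 1 x - jet φ 1 1 x * jet χ 1 0 x)
    - 2 * (u x 0)⁻¹ ^ 2 * jet u 1 0 x * (jet φ 1 0 x * jet χ 2 1 x - jet φ 2 1 x * jet χ 1 0 x)
    + (2 * jet u 1 1 x * (u x 0)⁻¹ ^ 2 - 4 * u x 1 * (u x 0)⁻¹ ^ 3 * jet u 1 0 x)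
      * (jet φ 1 1 x * jet χ 2 1 x - jet φ 2 1 x * jet χ 1 1 x)
    + 2 * u x 1 * (u x 0)⁻¹ ^ 2 * (jet φ 1 1 x * jet χ 3 1 x - jet φ 3 1 x * jet χ 1 1 x)

/-- The derivative of `fluxZ`. -/
def fluxZ' (u φ χ : Field1) (x : ℝ) : ℝ :=
  1 / 2 * (u x 0)⁻¹ * (jet φ 1 0 x * jet χ 3 0 x - jet φ 3 0 x * jet χ 1 0 x)
    - 1 / 2 * (u x 0)⁻¹ ^ 2 * jet u 1 0 x * (jet φ 1 0 x * jet χ 2 0 x - jet φ 2 0 x * jet χ 1 0 x)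
    + (1 / 2 * (u x 0)⁻¹ ^ 2 * jet u 2 1 x - 2 * (u x 0)⁻¹ ^ 3 * jet u 1 0 x * jet u 1 1 x
        - (u x 0)⁻¹ ^ 3 * jet u 2 0 x * u x 1 + 3 * (u x 0)⁻¹ ^ 4 * jet u 1 0 x ^ 2 * u x 1)
      * (jet φ 1 0 x * jet χ 1 1 x - jet φ 1 1 x * jet χ 1 0 x)
    + (1 / 2 * (u x 0)⁻¹ ^ 2 * jet u 1 1 x - (u x 0)⁻¹ ^ 3 * jet u 1 0 x * u x 1)
      * (3 * (jet φ 1 0 x * jet χ 2 1 x - jet φ 2 1 x * jet χ 1 0 x)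
        + (jet φ 1 1 x * jet χ 2 0 x - jet φ 2 0 x * jet χ 1 1 x))
    + u x 1 * (u x 0)⁻¹ ^ 2 * (jet φ 1 0 x * jet χ 3 1 x - jet φ 3 1 x * jet χ 1 0 x
      + (jet φ 1 1 x * jet χ 3 0 x - jet φ 3 0 x * jet χ 1 1 x))
    + (3 * u x 1 * jet u 1 1 x * (u x 0)⁻¹ ^ 3 - 9 / 2 * u x 1 ^ 2 * (u x 0)⁻¹ ^ 4 * jet u 1 0 x)
      * (jet φ 1 1 x * jet χ 2 1 x - jet φ 2 1 x * jet χ 1 1 x)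
    + 3 / 2 * u x 1 ^ 2 * (u x 0)⁻¹ ^ 3 * (jet φ 1 1 x * jet χ 3 1 x - jet φ 3 1 x * jet χ 1 1 x)

/-- The derivative of `fluxB`. -/
def fluxB' (u φ χ : Field1) (x : ℝ) : ℝ :=
  (u x 0)⁻¹ ^ 3 * (jet φ 1 1 x * jet χ 3 1 x - jet φ 3 1 x * jet χ 1 1 x)
    - 3 * (u x 0)⁻¹ ^ 4 * jet u 1 0 x * (jet φ 1 1 x * jet χ 2 1 x - jet φ 2 1 x * jet χ 1 1 x)

lemma hasDerivAt_bracket (hφ : ContDiff ℝ ∞ φ) (hχ : ContDiff ℝ ∞ χ) (m n : ℕ) (i j : Fin 2)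
    (x : ℝ) : HasDerivAt (fun x => jet φ m i x * jet χ n j x - jet φ n j x * jet χ m i x)
      (jet φ (m + 1) i x * jet χ n j x + jet φ m i x * jet χ (n + 1) j x
        - (jet φ (n + 1) j x * jet χ m i x + jet φ n j x * jet χ (m + 1) i x)) x :=
  ((hasDerivAt_jet hφ m i x).mul (hasDerivAt_jet hχ n j x)).sub
    ((hasDerivAt_jet hφ n j x).mul (hasDerivAt_jet hχ m i x))

lemma hasDerivAt_fluxY (hu : ContDiff ℝ ∞ u) {x : ℝ} (h0 : u x 0 ≠ 0) (hφ : ContDiff ℝ ∞ φ)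
    (hχ : ContDiff ℝ ∞ χ) : HasDerivAt (fluxY u φ χ) (fluxY' u φ χ x) x := by
  have ha := hasDerivAt_recip hu h0
  have hb := hasDerivAt_bracket hφ hχ
  refine HasDerivAt.congr_deriv (((ha.mul ((hb 1 2 0 1 x).add (hb 1 2 1 0 x))).sub
    (((ha.pow 2).mul (hasDerivAt_jet hu 1 0 x)).mul (hb 1 1 0 1 x))).add
    ((((hasDerivAt_component hu 1 x).const_mul 2).mul (ha.pow 2)).mul (hb 1 2 1 1 x))) ?_
  simp only [fluxY']; push_cast; simp; ring

lemma hasDerivAt_fluxZ (hu : ContDiff ℝ ∞ u) {x : ℝ} (h0 : u x 0 ≠ 0) (hφ : ContDiff ℝ ∞ φ)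
    (hχ : ContDiff ℝ ∞ χ) : HasDerivAt (fluxZ u φ χ) (fluxZ' u φ χ x) x := by
  have ha := hasDerivAt_recip hu h0
  have hb := hasDerivAt_bracket hφ hχ
  have hv := hasDerivAt_component hu 1 x
  refine HasDerivAt.congr_deriv ((((ha.const_mul (1 / 2)).mul (hb 1 2 0 0 x)).add
    (((((ha.pow 2).const_mul (1 / 2)).mul (hasDerivAt_jet hu 1 1 x)).sub
      (((ha.pow 3).mul (hasDerivAt_jet hu 1 0 x)).mul hv)).mul (hb 1 1 0 1 x))).add
    ((hv.mul (ha.pow 2)).mul ((hb 1 2 0 1 x).add (hb 1 2 1 0 x)))|>.add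
    ((((hv.pow 2).const_mul (3 / 2)).mul (ha.pow 3)).mul (hb 1 2 1 1 x))) ?_
  simp only [fluxZ']; push_cast; simp; ring

lemma hasDerivAt_fluxB (hu : ContDiff ℝ ∞ u) {x : ℝ} (h0 : u x 0 ≠ 0) (hφ : ContDiff ℝ ∞ φ)
    (hχ : ContDiff ℝ ∞ χ) : HasDerivAt (fluxB u φ χ) (fluxB' u φ χ x) x := by
  refine HasDerivAt.congr_deriv (((hasDerivAt_recip hu h0).pow 3).mul
    (hasDerivAt_bracket hφ hχ 1 2 1 1 x)) ?_
  simp only [fluxB']; push_cast; simp; ring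

lemma hasDerivAt_flux (c₁ c₂ c₃ c₄ c₆ : ℝ) (hu : ContDiff ℝ ∞ u) {x : ℝ} (h0 : u x 0 ≠ 0)
    (hφ : ContDiff ℝ ∞ φ) (hψ : ContDiff ℝ ∞ ψ) (hχ : ContDiff ℝ ∞ χ) :
    HasDerivAt (flux c₁ c₂ c₃ c₄ c₆ u φ ψ χ)
      (jet ψ 1 0 x * (c₁ / 2 * fluxY u φ χ x + c₂ * fluxZ u φ χ x - c₃ * fluxB u φ χ x)
        + ψ x 0 * (c₁ / 2 * fluxY' u φ χ x + c₂ * fluxZ' u φ χ x - c₃ * fluxB' u φ χ x)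
        + (jet ψ 1 1 x * (-c₁ * fluxZ u φ χ x + c₄ * fluxY u φ χ x - c₆ / 2 * fluxB u φ χ x)
        + ψ x 1 * (-c₁ * fluxZ' u φ χ x + c₄ * fluxY' u φ χ x - c₆ / 2 * fluxB' u φ χ x))) x := by
  have hY := hasDerivAt_fluxY hu h0 hφ hχ
  have hZ := hasDerivAt_fluxZ hu h0 hφ hχ
  have hB := hasDerivAt_fluxB hu h0 hφ hχ
  exact ((hasDerivAt_component hψ 0 x).mul (((hY.const_mul (c₁ / 2)).add (hZ.const_mul c₂)).sub
    (hB.const_mul c₃))).add ((hasDerivAt_component hψ 1 x).mul (((hZ.const_mul (-c₁)).add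
    (hY.const_mul c₄)).sub (hB.const_mul (c₆ / 2))))

end

/-- The metric `g` has the rational form with constants `c₁, …, c₆` and `Γ` is the corresponding
system of symbols. -/
structure IsRational (U : Set Pt) (g : Pt → Fin 2 → Fin 2 → ℝ)
    (Γ : Pt → Fin 2 → Fin 2 → Fin 2 → ℝ) (c₁ c₂ c₃ c₄ c₅ c₆ : ℝ) : Prop where
  g00 : ∀ v ∈ U, g v 0 0 = c₁ * v 0 + c₂ * v 1
  g01 : ∀ v ∈ U, g v 0 1 = c₄ * v 0 + c₃ / v 0 + c₂ * (v 1) ^ 2 / (2 * v 0)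
  g10 : ∀ v ∈ U, g v 1 0 = g v 0 1
  g11 : ∀ v ∈ U, g v 1 1 = 2 * c₄ * v 1 + c₆ / v 0 - c₁ * (v 1) ^ 2 / v 0 + c₅
  symbols : ∀ v ∈ U, ∀ i j k, Γ v i j k = rationalSymbols c₁ c₂ c₃ c₄ c₆ v i j k
  rel₁ : c₂ * c₆ + 2 * c₁ * c₃ = 0
  rel₂ : c₂ * c₅ = 0
  rel₃ : c₁ * c₅ = 0

section
variable {c₁ c₂ c₃ c₄ c₅ c₆ : ℝ}

/-- The partial derivatives of the rational symbols. -/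
lemma hasPartials_rationalSymbols (c₁ c₂ c₃ c₄ c₆ : ℝ) {v : Pt} (h0 : v 0 ≠ 0) (i j k : Fin 2) :
    HasPartials (fun v => rationalSymbols c₁ c₂ c₃ c₄ c₆ v i j k)
      (![![![fun _ => 0, fun _ => 0], ![fun _ => 0, fun _ => 0]],
        ![![![2 * (c₃ + c₂ / 2 * v 1 ^ 2) * (v 0)⁻¹ ^ 3, -c₂ * v 1 * (v 0)⁻¹ ^ 2],
          ![-c₂ * v 1 * (v 0)⁻¹ ^ 2, c₂ * (v 0)⁻¹]],
          ![![-(c₁ * v 1 ^ 2 - c₆) * (v 0)⁻¹ ^ 3, c₁ * v 1 * (v 0)⁻¹ ^ 2],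
          ![c₁ * v 1 * (v 0)⁻¹ ^ 2, -c₁ * (v 0)⁻¹]]]] i j k) v := by
  have hx := HasPartials.coord (v := v) 0
  have hy := HasPartials.coord (v := v) 1
  have ha := hx.inv h0
  have C := fun c => HasPartials.const (v := v) c
  fin_cases i <;> fin_cases j <;> fin_cases k <;> simp [rationalSymbols]
  · exact C _
  · exact C _
  · exact C _
  · exact C _
  · refine ((((C (-c₃)).add ((C (-(c₂ / 2))).mul (hy.mul hy))).mul (ha.mul ha)).congr
      (.of_forall fun w => ?_)).congr_partials fun k => ?_
    · ring
    · fin_cases k <;> simp <;> ring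
  · refine (((((C c₂).mul hy).mul ha).add (C (c₁ / 2))).congr
      (.of_forall fun w => ?_)).congr_partials fun k => ?_
    · ring
    · fin_cases k <;> simp
  · refine ((((C (-(c₆ / 2))).add ((C (c₁ / 2)).mul (hy.mul hy))).mul (ha.mul ha)).congr
      (.of_forall fun w => ?_)).congr_partials fun k => ?_
    · ring
    · fin_cases k <;> simp <;> ring
  · refine ((((C (-c₁)).mul (hy.mul ha)).add (C c₄)).congr
      (.of_forall fun w => ?_)).congr_partials fun k => ?_
    · ring
    · fin_cases k <;> simp; ring

lemma smoothSymbols_rationalSymbols (hU0 : ∀ v ∈ U, v 0 ≠ 0) (c₁ c₂ c₃ c₄ c₆ : ℝ) :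
    SmoothSymbols U (rationalSymbols c₁ c₂ c₃ c₄ c₆) := by
  have hx : ContDiffOn ℝ ∞ (fun v : Pt => (v 0)⁻¹) U :=
    (contDiff_apply ℝ ℝ (0 : Fin 2)).contDiffOn.inv hU0
  have hy : ContDiffOn ℝ ∞ (fun v : Pt => v 1) U := (contDiff_apply ℝ ℝ (1 : Fin 2)).contDiffOn
  have C := fun c : ℝ => contDiffOn_const (𝕜 := ℝ) (n := ∞) (s := U) (c := c)
  intro i j k
  fin_cases i <;> fin_cases j <;> fin_cases k <;> simp [rationalSymbols]
  · exact C _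
  · exact C _
  · exact C _
  · exact C _
  · exact ((C (-c₂ / 2)).mul (hy.pow 2) |>.add (C (-c₃))).mul (hx.pow 2) |>.congr
      fun v _ => by simp only [inv_pow]; ring
  · exact (((C c₂).mul hy).mul hx).add (C _)
  · exact ((((C (c₁)).mul (hy.pow 2)).sub (C c₆)).mul (C (1 / 2))).mul (hx.pow 2) |>.congr
      fun v _ => by simp only [inv_pow]; ring
  · exact (C _).sub (((C c₁).mul hy).mul hx)

namespace IsRational

lemma partials_symbols (h : IsRational U g Γ c₁ c₂ c₃ c₄ c₅ c₆) (hU : IsOpen U)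
    (hU0 : ∀ v ∈ U, v 0 ≠ 0) {v : Pt} (hv : v ∈ U)
    (i j k : Fin 2) : HasPartials (fun v => Γ v i j k)
      (![![![fun _ => 0, fun _ => 0], ![fun _ => 0, fun _ => 0]],
        ![![![2 * (c₃ + c₂ / 2 * v 1 ^ 2) * (v 0)⁻¹ ^ 3, -c₂ * v 1 * (v 0)⁻¹ ^ 2],
          ![-c₂ * v 1 * (v 0)⁻¹ ^ 2, c₂ * (v 0)⁻¹]],
          ![![-(c₁ * v 1 ^ 2 - c₆) * (v 0)⁻¹ ^ 3, c₁ * v 1 * (v 0)⁻¹ ^ 2],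
          ![c₁ * v 1 * (v 0)⁻¹ ^ 2, -c₁ * (v 0)⁻¹]]]] i j k) v :=
  (hasPartials_rationalSymbols c₁ c₂ c₃ c₄ c₆ (hU0 v hv) i j k).congr
    (Filter.mem_of_superset (hU.mem_nhds hv) fun w hw => (h.symbols w hw i j k).symm)

lemma curl (h : IsRational U g Γ c₁ c₂ c₃ c₄ c₅ c₆) (hU : IsOpen U)
    (hU0 : ∀ v ∈ U, v 0 ≠ 0) {v : Pt} (hv : v ∈ U)
    (i j k l : Fin 2) : partialD k (fun v => Γ v i j l) v = partialD l (fun v => Γ v i j k) v := by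
  rw [(h.partials_symbols hU hU0 hv i j l).2, (h.partials_symbols hU hU0 hv i j k).2]
  fin_cases i <;> fin_cases j <;> fin_cases k <;> fin_cases l <;> simp

lemma skewCoeffs (h : IsRational U g Γ c₁ c₂ c₃ c₄ c₅ c₆) (hU : IsOpen U)
    (hU0 : ∀ v ∈ U, v 0 ≠ 0) : SkewCoeffs U g Γ := by
  refine ⟨fun v hv i j => ?_, fun v hv i j k => ?_⟩
  · fin_cases i <;> fin_cases j <;> simp [h.g10 v hv]
  have h0 := hU0 v hv
  have hx := HasPartials.coord (v := v) 0
  have hy := HasPartials.coord (v := v) 1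
  have ha := hx.inv h0
  have C := fun c => HasPartials.const (v := v) c
  have near : ∀ {p : Pt → Prop}, (∀ w ∈ U, p w) → ∀ᶠ w in 𝓝 v, p w := fun hp =>
    Filter.mem_of_superset (hU.mem_nhds hv) hp
  have e00 := (((C c₁).mul hx).add ((C c₂).mul hy)).congr
    (near fun w hw => (h.g00 w hw).symm)
  have f01 := (((C c₄).mul hx).add ((C c₃).mul ha)).add (((C (c₂ / 2)).mul (hy.mul hy)).mul ha)
  have e01 := f01.congr (near fun w hw => show _ = g w 0 1 by
    rw [h.g01 w hw]; have := hU0 w hw; field_simp)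
  have e10 := f01.congr (near fun w hw => show _ = g w 1 0 by
    rw [h.g10 w hw, h.g01 w hw]; have := hU0 w hw; field_simp)
  have e11 := (((((C (2 * c₄)).mul hy).add ((C c₆).mul ha)).sub
    (((C c₁).mul (hy.mul hy)).mul ha)).add (C c₅)).congr (near fun w hw => show _ = g w 1 1 by
    rw [h.g11 w hw]; have := hU0 w hw; field_simp)
  rw [h.symbols v hv, h.symbols v hv]
  fin_cases i <;> fin_cases j
  · refine (e00.2 k).trans ?_
    fin_cases k <;> simp [rationalSymbols]
  · refine (e01.2 k).trans ?_
    fin_cases k <;> simp [rationalSymbols] <;> field_simp <;> ring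
  · refine (e10.2 k).trans ?_
    fin_cases k <;> simp [rationalSymbols] <;> field_simp <;> ring
  · refine (e11.2 k).trans ?_
    fin_cases k <;> simp [rationalSymbols] <;> field_simp <;> ring

lemma symbols_mul_metric (h : IsRational U g Γ c₁ c₂ c₃ c₄ c₅ c₆)
    (hU0 : ∀ v ∈ U, v 0 ≠ 0) {v : Pt} (hv : v ∈ U) (i : Fin 2) :
    ∑ k, Γ v 0 i k * g v k 1 = ∑ k, Γ v 1 i k * g v k 0 := by
  have h0 := hU0 v hv
  have r₁ := h.rel₁
  have r₂ := h.rel₂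
  have r₃ := h.rel₃
  simp only [Fin.sum_univ_two, h.symbols v hv, h.g10 v hv, h.g00 v hv, h.g01 v hv, h.g11 v hv]
  fin_cases i <;> simp [rationalSymbols] <;> field_simp
  · linear_combination 2 * v 0 * r₁ + 2 * v 0 ^ 2 * r₂
  · linear_combination v 1 * r₁ - v 0 ^ 2 * r₃

lemma symbols_mul_symbols (h : IsRational U g Γ c₁ c₂ c₃ c₄ c₅ c₆)
    {v : Pt} (hv : v ∈ U) (h0 : v 0 ≠ 0) (j l : Fin 2) :
    ∑ k, Γ v j 0 k * Γ v k 1 l = ∑ k, Γ v j 1 k * Γ v k 0 l := by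
  have r₁ := h.rel₁
  simp only [Fin.sum_univ_two, h.symbols v hv]
  fin_cases j <;> fin_cases l <;> simp [rationalSymbols] <;> field_simp
  · linear_combination -r₁
  · ring
  · linear_combination -2 * v 1 * r₁
  · linear_combination r₁

/-- The density of `[P, R]` is the derivative of the cyclic sum of `flux`. -/
lemma hasDerivAt_sum_flux (h : IsRational U g Γ c₁ c₂ c₃ c₄ c₅ c₆) (hU : IsOpen U)
    (hU0 : ∀ v ∈ U, v 0 ≠ 0) (hu : IsFieldIn U u)
    (hφ : ContDiff ℝ ∞ φ) (hψ : ContDiff ℝ ∞ ψ) (hχ : ContDiff ℝ ∞ χ) (x : ℝ) :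
    HasDerivAt (fun x => flux c₁ c₂ c₃ c₄ c₆ u φ ψ χ x + flux c₁ c₂ c₃ c₄ c₆ u ψ χ φ x
        + flux c₁ c₂ c₃ c₄ c₆ u χ φ ψ x)
      (mixedDensity g Γ u φ ψ χ x + mixedDensity g Γ u ψ χ φ x + mixedDensity g Γ u χ φ ψ x) x := by
  have hv := hu.2 x
  have h0 := hU0 _ hv
  refine HasDerivAt.congr_deriv (((hasDerivAt_flux c₁ c₂ c₃ c₄ c₆ hu.1 h0 hφ hψ hχ).add
    (hasDerivAt_flux c₁ c₂ c₃ c₄ c₆ hu.1 h0 hψ hχ hφ)).add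
    (hasDerivAt_flux c₁ c₂ c₃ c₄ c₆ hu.1 h0 hχ hφ hψ)) ?_
  have hc := fun i j => h.curl hU hU0 hv i j 0 1
  have e01 : g (u x) 0 1 = c₄ * u x 0 + c₃ * (u x 0)⁻¹ + c₂ / 2 * u x 1 ^ 2 * (u x 0)⁻¹ := by
    rw [h.g01 _ hv]; field_simp
  have e11 : g (u x) 1 1 = 2 * c₄ * u x 1 + c₆ * (u x 0)⁻¹ - c₁ * u x 1 ^ 2 * (u x 0)⁻¹ + c₅ := by
    rw [h.g11 _ hv]; field_simp
  have ea : u x 0 * (u x 0)⁻¹ = 1 := mul_inv_cancel₀ h0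
  simp only [mixedDensity, firstForm, firstOrderOp_apply, Fin.sum_univ_two, hc, sub_self, zero_mul,
    add_zero, h.symbols _ hv, h.g10 _ hv, h.g00 _ hv, e01, e11,
    thirdOrderOp_apply_zero hu.1 hφ h0, thirdOrderOp_apply_one hu.1 hφ h0,
    thirdOrderOp_apply_zero hu.1 hψ h0, thirdOrderOp_apply_one hu.1 hψ h0,
    thirdOrderOp_apply_zero hu.1 hχ h0, thirdOrderOp_apply_one hu.1 hχ h0]
  simp only [thirdForm, rationalSymbols, fluxY, fluxY', fluxZ, fluxZ', fluxB, fluxB', recipJet,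
    ratioJet, Matrix.cons_val_zero, Matrix.cons_val_one, Matrix.cons_val_fin_one]
  generalize (u x 0)⁻¹ = a at *
  -- a polynomial identity in the jets and `a = 1 / u¹`, up to a multiple of `u¹ a = 1`
  linear_combination (-((c₁ * jet ψ 1 0 x + c₄ * jet ψ 1 1 x)
        * (a * (jet φ 1 1 x * jet χ 2 0 x - jet φ 2 0 x * jet χ 1 1 x)
          + 2 * a ^ 2 * u x 1 * (jet φ 1 1 x * jet χ 2 1 x - jet φ 2 1 x * jet χ 1 1 x))
      + (c₁ * jet χ 1 0 x + c₄ * jet χ 1 1 x)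
        * (a * (jet ψ 1 1 x * jet φ 2 0 x - jet ψ 2 0 x * jet φ 1 1 x)
          + 2 * a ^ 2 * u x 1 * (jet ψ 1 1 x * jet φ 2 1 x - jet ψ 2 1 x * jet φ 1 1 x))
      + (c₁ * jet φ 1 0 x + c₄ * jet φ 1 1 x)
        * (a * (jet χ 1 1 x * jet ψ 2 0 x - jet χ 2 0 x * jet ψ 1 1 x)
          + 2 * a ^ 2 * u x 1 * (jet χ 1 1 x * jet ψ 2 1 x - jet χ 2 1 x * jet ψ 1 1 x)))
      + c₄ * a * (jet ψ 1 0 x * (jet φ 1 1 x * jet χ 2 1 x - jet φ 2 1 x * jet χ 1 1 x)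
        + jet χ 1 0 x * (jet ψ 1 1 x * jet φ 2 1 x - jet ψ 2 1 x * jet φ 1 1 x)
        + jet φ 1 0 x * (jet χ 1 1 x * jet ψ 2 1 x - jet χ 2 1 x * jet ψ 1 1 x))) * ea

lemma isHamiltonian (h : IsRational U g Γ c₁ c₂ c₃ c₄ c₅ c₆) (hU : IsOpen U)
    (hU0 : ∀ v ∈ U, v 0 ≠ 0) (hg : SmoothMetric U g) (hΓ : SmoothSymbols U Γ) :
    IsHamiltonian U (firstOrderOp g Γ) := by
  have hs := h.skewCoeffs hU hU0
  refine ⟨isSkewAdjoint_of_skewCoeffs hU hg hΓ hs, fun u φ ψ χ hu hφ hψ hχ => ?_⟩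
  rw [schouten_first_first hU hg hΓ hs hu hφ hψ hχ]
  have e : ∀ x, firstDensity g Γ u φ ψ χ x + firstDensity g Γ u ψ χ φ x
      + firstDensity g Γ u χ φ ψ x = 0 := fun x =>
    sum_firstDensity_eq_zero (fun i j k l => h.curl hU hU0 (hu.2 x) i j k l)
      (h.symbols_mul_metric hU0 (hu.2 x))
      (h.symbols_mul_symbols (hu.2 x) (hU0 _ (hu.2 x)))
  simp [e]

lemma schoutenCommute (h : IsRational U g Γ c₁ c₂ c₃ c₄ c₅ c₆) (hU : IsOpen U)
    (hU0 : ∀ v ∈ U, v 0 ≠ 0) (hg : SmoothMetric U g) (hΓ : SmoothSymbols U Γ) :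
    SchoutenCommute U (firstOrderOp g Γ) thirdOrderOp := by
  intro u φ ψ χ hu hφ hψ hχ
  rw [schouten_first_third hU hU0 hg hΓ (h.skewCoeffs hU hU0) hu hφ hψ hχ]
  have hT := h.hasDerivAt_sum_flux hU hU0 hu hφ.1 hψ.1 hχ.1
  refine integral_eq_zero_of_hasDerivAt_of_integrable hT
    (((integrable_mixedDensity hU hU0 hg hΓ hu hφ hψ hχ).add
    (integrable_mixedDensity hU hU0 hg hΓ hu hψ hχ hφ)).add
    (integrable_mixedDensity hU hU0 hg hΓ hu hχ hφ hψ)) ?_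
  have hc := continuous_iff_continuousAt.2 fun x => (hT x).continuousAt
  refine hc.integrable_of_hasCompactSupport (HasCompactSupport.intro hφ.2 fun x hx => ?_)
  simp [flux, fluxY, fluxZ, fluxB, apply_eq_zero hx, jet_eq_zero hx]

end IsRational

end

/-! ### Localized test covectors -/

/-- A smooth scalar function supported in the interval `(-1, 1)`. -/
def IsBump (ρ : ℝ → ℝ) : Prop := ContDiff ℝ ∞ ρ ∧ tsupport ρ ⊆ Ioo (-1) 1

section
variable {ρ : ℝ → ℝ}

lemma IsBump.hasCompactSupport (hρ : IsBump ρ) : HasCompactSupport ρ :=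
  isCompact_Icc.of_isClosed_subset (isClosed_tsupport ρ) (hρ.2.trans Ioo_subset_Icc_self)

lemma contDiff_iteratedDeriv (hρ : ContDiff ℝ ∞ ρ) (n : ℕ) : ContDiff ℝ ∞ (iteratedDeriv n ρ) := by
  have h := hρ.iterate_deriv n
  rwa [← iteratedDeriv_eq_iterate] at h

lemma hasDerivAt_iteratedDeriv (hρ : ContDiff ℝ ∞ ρ) (n : ℕ) (x : ℝ) :
    HasDerivAt (iteratedDeriv n ρ) (iteratedDeriv (n + 1) ρ x) x := by
  rw [iteratedDeriv_succ]
  exact ((contDiff_iteratedDeriv hρ n).differentiable (by simp) x).hasDerivAt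

lemma iteratedDeriv_eq_zero {x : ℝ} (hx : x ∉ tsupport ρ) (n : ℕ) : iteratedDeriv n ρ x = 0 := by
  rw [Filter.EventuallyEq.iteratedDeriv_eq n (notMem_tsupport_iff_eventuallyEq.1 hx)]
  change iteratedDeriv n (fun _ => (0 : ℝ)) x = 0
  simp

/-- The rescaled bump `x ↦ ρ (c x)`, `c ≥ 1`. -/
lemma IsBump.comp_mul (hρ : IsBump ρ) {c : ℝ} (hc : 1 ≤ c) : IsBump fun x => ρ (c * x) := by
  refine ⟨hρ.1.comp (contDiff_const.mul contDiff_id), fun x hx => ?_⟩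
  have h := hρ.2 (tsupport_comp_subset_preimage ρ (f := fun x => c * x) (by fun_prop) hx)
  constructor <;> nlinarith [h.1, h.2]

lemma exists_bump : ∃ ρ : ℝ → ℝ, IsBump ρ ∧ ∫ x, ρ x ≠ 0 := by
  let f : ContDiffBump (0 : ℝ) := ⟨1 / 4, 1 / 2, by norm_num, by norm_num⟩
  refine ⟨f, ⟨f.contDiff, ?_⟩, f.integral_pos.ne'⟩
  rw [f.tsupport_eq, Real.closedBall_eq_Icc]
  intro x hx
  simp only [f, mem_Icc] at hx
  constructor <;> linarith [hx.1, hx.2]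

/-- A smooth function of compact support that equals `1` on `[-1, 1]`. -/
lemma exists_cutoff : ∃ θ : ℝ → ℝ, ContDiff ℝ ∞ θ ∧ HasCompactSupport θ ∧
    ∀ x ∈ Icc (-1 : ℝ) 1, θ x = 1 := by
  let f : ContDiffBump (0 : ℝ) := ⟨1, 2, by norm_num, by norm_num⟩
  refine ⟨f, f.contDiff, f.hasCompactSupport, fun x hx => f.one_of_mem_closedBall ?_⟩
  rwa [Real.closedBall_eq_Icc, zero_sub, zero_add]

/-- Integration by parts: `∫ xⁿ ρ⁽ⁿ⁾ dx = (-1)ⁿ n! ∫ ρ dx`, for `n ≤ 3`. -/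
lemma integral_moments (hρ : IsBump ρ) (c₀ c₁ c₂ c₃ : ℝ) :
    ∫ x, (c₀ * ρ x + c₁ * x * iteratedDeriv 1 ρ x + c₂ * x ^ 2 * iteratedDeriv 2 ρ x
      + c₃ * x ^ 3 * iteratedDeriv 3 ρ x) = (c₀ - c₁ + 2 * c₂ - 6 * c₃) * ∫ x, ρ x := by
  have hc := fun n => (contDiff_iteratedDeriv hρ.1 n).continuous
  have h0 := hρ.1.continuous
  have h1 := hc 1
  have h2 := hc 2
  have h3 := hc 3
  rw [← integral_const_mul]
  refine integral_eq_of_hasDerivAt (K := tsupport ρ) (S := fun x =>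
    (c₁ * x - 2 * c₂ * x + 6 * c₃ * x) * ρ x + (c₂ * x ^ 2 - 3 * c₃ * x ^ 2) * iteratedDeriv 1 ρ x
      + c₃ * x ^ 3 * iteratedDeriv 2 ρ x) hρ.hasCompactSupport (by fun_prop) (by fun_prop)
    ?_ ?_ ?_ ?_
  · intro x hx; simp [iteratedDeriv_eq_zero hx, image_eq_zero_of_notMem_tsupport hx]
  · intro x hx; simp [image_eq_zero_of_notMem_tsupport hx]
  · intro x hx; simp [iteratedDeriv_eq_zero hx, image_eq_zero_of_notMem_tsupport hx]
  · intro x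
    have d0 : HasDerivAt ρ (iteratedDeriv 1 ρ x) x := by
      simpa using hasDerivAt_iteratedDeriv hρ.1 0 x
    have hx := hasDerivAt_id' x
    refine HasDerivAt.congr_deriv ((((((hx.const_mul c₁).sub (hx.const_mul (2 * c₂))).add
      (hx.const_mul (6 * c₃))).mul d0).add ((((hx.pow 2).const_mul c₂).sub
      ((hx.pow 2).const_mul (3 * c₃))).mul (hasDerivAt_iteratedDeriv hρ.1 1 x))).add
      (((hx.pow 3).const_mul c₃).mul (hasDerivAt_iteratedDeriv hρ.1 2 x))) ?_
    simp; ring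

/-- If `∫ ∑ₙ xⁿ Kₙ(x) ρ⁽ⁿ⁾(x) dx = 0` for all bumps `ρ`, then `∑ₙ (-1)ⁿ n! Kₙ(0) = 0`: this
follows by concentrating a fixed bump at the origin. -/
lemma moments_eq_zero {K₀ K₁ K₂ K₃ : ℝ → ℝ} (h₀ : Continuous K₀)
    (h₁ : Continuous K₁) (h₂ : Continuous K₂) (h₃ : Continuous K₃)
    (h : ∀ ρ, IsBump ρ → ∫ x, (K₀ x * ρ x + K₁ x * x * iteratedDeriv 1 ρ x
      + K₂ x * x ^ 2 * iteratedDeriv 2 ρ x + K₃ x * x ^ 3 * iteratedDeriv 3 ρ x) = 0) :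
    K₀ 0 - K₁ 0 + 2 * K₂ 0 - 6 * K₃ 0 = 0 := by
  obtain ⟨ρ, hρ, hpos⟩ := exists_bump
  let J : ℝ → ℝ := fun t => ∫ x in tsupport ρ, (K₀ (t * x) * ρ x
    + K₁ (t * x) * x * iteratedDeriv 1 ρ x + K₂ (t * x) * x ^ 2 * iteratedDeriv 2 ρ x
    + K₃ (t * x) * x ^ 3 * iteratedDeriv 3 ρ x)
  have hJ : ∀ t, J t = ∫ x, (K₀ (t * x) * ρ x
      + K₁ (t * x) * x * iteratedDeriv 1 ρ x + K₂ (t * x) * x ^ 2 * iteratedDeriv 2 ρ x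
      + K₃ (t * x) * x ^ 3 * iteratedDeriv 3 ρ x) := fun t =>
    setIntegral_eq_integral_of_forall_compl_eq_zero fun x hx => by
      simp [iteratedDeriv_eq_zero hx, image_eq_zero_of_notMem_tsupport hx]
  have hc := fun n => (contDiff_iteratedDeriv hρ.1 n).continuous
  have hJc : Continuous J := by
    refine continuous_parametric_integral_of_continuous ?_ hρ.hasCompactSupport
    have := hρ.1.continuous
    have := hc 1
    have := hc 2
    have := hc 3
    simp only [Function.uncurry_def]
    fun_prop
  have hJ0 : ∀ t ∈ Ioc (0 : ℝ) 1, J t = 0 := by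
    rintro t ⟨ht, ht1⟩
    have hb := hρ.comp_mul ((one_le_inv₀ ht).2 ht1)
    have e := h _ hb
    have hd : ∀ n, iteratedDeriv n (fun x => ρ (t⁻¹ * x)) = fun x =>
        t⁻¹ ^ n * iteratedDeriv n ρ (t⁻¹ * x) := fun n =>
      iteratedDeriv_comp_const_mul (hρ.1.of_le (by exact_mod_cast le_top)) _
    simp only [hd] at e
    have hcv := Measure.integral_comp_mul_left (fun x => K₀ (t * x) * ρ x
      + K₁ (t * x) * x * iteratedDeriv 1 ρ x + K₂ (t * x) * x ^ 2 * iteratedDeriv 2 ρ x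
      + K₃ (t * x) * x ^ 3 * iteratedDeriv 3 ρ x) t⁻¹
    rw [← hJ, inv_inv, abs_of_pos ht, smul_eq_mul] at hcv
    have e' : t * J t = 0 := by
      rw [← hcv, ← e]
      congr 1
      funext x
      rw [mul_inv_cancel_left₀ ht.ne']
      ring
    exact (mul_eq_zero.1 e').resolve_left ht.ne'
  have hlim : J 0 = 0 := by
    have h1 : Tendsto J (𝓝[>] 0) (𝓝 (J 0)) := hJc.continuousAt.tendsto.mono_left nhdsWithin_le_nhds
    have h2 : Tendsto J (𝓝[>] 0) (𝓝 0) := tendsto_const_nhds.congr' <|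
      Filter.mem_of_superset (Ioc_mem_nhdsGT one_pos) fun t ht => (hJ0 t ht).symm
    exact tendsto_nhds_unique h1 h2
  rw [hJ] at hlim
  simp only [zero_mul] at hlim
  have := integral_moments hρ (K₀ 0) (K₁ 0) (K₂ 0) (K₃ 0)
  rw [hlim] at this
  exact (mul_eq_zero.1 this.symm).resolve_right hpos

lemma isTest_smul_const (hρ : IsBump ρ) (f : Pt) : IsTest fun x => ρ x • f :=
  ⟨hρ.1.smul contDiff_const, hρ.hasCompactSupport.smul_right⟩

/-- A test covector that equals `xⁿ f` on `[-1, 1]`, described by its jets on `(-1, 1)`. -/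
lemma exists_monomial_test (n : ℕ) (f : Pt) : ∃ ψ : Field1, IsTest ψ ∧
    ∀ x ∈ Ioo (-1 : ℝ) 1, ∀ m i, jet ψ m i x = n.descFactorial m * x ^ (n - m) * f i := by
  obtain ⟨θ, h1, h2, h3⟩ := exists_cutoff
  have hs : ContDiff ℝ ∞ fun x => θ x * x ^ n := h1.mul (contDiff_id.pow n)
  refine ⟨fun x => (θ x * x ^ n) • f, ⟨hs.smul contDiff_const, h2.mul_right.smul_right⟩,
    fun x hx m i => ?_⟩
  rw [jet_smul_const hs]
  have e : (fun x => θ x * x ^ n) =ᶠ[𝓝 x] fun x => x ^ n :=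
    Filter.mem_of_superset (Ioo_mem_nhds hx.1 hx.2) fun y hy => by
      simp [h3 y (Ioo_subset_Icc_self hy)]
  rw [e.iteratedDeriv_eq m, iteratedDeriv_pow]

end

/-! ### Necessary conditions at a point -/

section
variable {U : Set Pt} {g : Pt → Fin 2 → Fin 2 → ℝ} {Γ : Pt → Fin 2 → Fin 2 → Fin 2 → ℝ}

/-- A bounded smooth function that equals `xⁿ` on `(-1, 1)`. -/
lemma exists_monomial_profile (n : ℕ) : ∃ (κ : ℝ → ℝ) (M : ℝ), ContDiff ℝ ∞ κ ∧
    (∀ x ∈ Ioo (-1 : ℝ) 1, κ x = x ^ n) ∧ 0 < M ∧ ∀ x, |κ x| < M := by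
  obtain ⟨θ, h1, h2, h3⟩ := exists_cutoff
  have hs : ContDiff ℝ ∞ fun x => θ x * x ^ n := h1.mul (contDiff_id.pow n)
  obtain ⟨C, hC⟩ := (h2.mul_right (f' := fun x => x ^ n)).exists_bound_of_continuous hs.continuous
  refine ⟨_, C + 1, hs, fun x hx => by simp [h3 x (Ioo_subset_Icc_self hx)], ?_, fun x => ?_⟩
  · linarith [(norm_nonneg _).trans (hC 0)]
  · have h : |θ x * x ^ n| ≤ C := hC x
    linarith

/-- For small `s > 0`, fields of the form `v + κ s q` with `|κ| < M` take values in `U`. -/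
lemma exists_scale (hU : IsOpen U) {v : Pt} (hv : v ∈ U) (q : Pt) {M : ℝ} (hM : 0 < M) :
    ∃ s : ℝ, 0 < s ∧ ∀ y : ℝ, |y| < M → v + y • s • q ∈ U := by
  obtain ⟨r, hr, hb⟩ := Metric.isOpen_iff.1 hU v hv
  have hd : 0 < M * (‖q‖ + 1) := by positivity
  refine ⟨r / (M * (‖q‖ + 1)), by positivity, fun y hy => hb ?_⟩
  rw [mem_ball_iff_norm, add_sub_cancel_left, norm_smul, norm_smul, Real.norm_eq_abs,
    Real.norm_eq_abs, abs_of_pos (show 0 < r / (M * (‖q‖ + 1)) by positivity)]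
  calc |y| * (r / (M * (‖q‖ + 1)) * ‖q‖) ≤ M * (r / (M * (‖q‖ + 1)) * ‖q‖) := by gcongr
    _ < M * (r / (M * (‖q‖ + 1)) * (‖q‖ + 1)) := by gcongr; linarith
    _ = r := by field_simp

/-- The field `v + κ q`. -/
def lineField (v q : Pt) (κ : ℝ → ℝ) : Field1 := fun x => v + κ x • q

lemma isFieldIn_lineField {v q : Pt} {κ : ℝ → ℝ} {M : ℝ} (hκ : ContDiff ℝ ∞ κ)
    (hM : ∀ x, |κ x| < M) (hq : ∀ y : ℝ, |y| < M → v + y • q ∈ U) :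
    IsFieldIn U (lineField v q κ) :=
  ⟨contDiff_const.add (hκ.smul contDiff_const), fun x => hq _ (hM x)⟩

lemma jet_lineField {v q : Pt} {κ : ℝ → ℝ} (n : ℕ) (i : Fin 2) (x : ℝ) :
    jet (lineField v q κ) (n + 1) i x = iteratedDeriv (n + 1) κ x * q i := by
  have : (fun y => lineField v q κ y i) = fun y => v i + κ y * q i := rfl
  rw [jet, this, iteratedDeriv_const_add]
  · simp
  · simp

lemma isFieldIn_const {v : Pt} (hv : v ∈ U) : IsFieldIn U fun _ => v :=
  ⟨contDiff_const, fun _ => hv⟩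

lemma jet_const (v : Pt) (n : ℕ) (i : Fin 2) (x : ℝ) : jet (fun _ => v) (n + 1) i x = 0 := by
  simp [jet, iteratedDeriv_const]

/-- Hadamard's lemma along the curve `v + κ q`. -/
lemma exists_quotient (hU : IsOpen U) {F : Pt → ℝ} (hF : ContDiffOn ℝ ∞ F U) {v q : Pt} {M : ℝ}
    (hM : 0 < M) (hq : ∀ y : ℝ, |y| < M → v + y • q ∈ U) {κ : ℝ → ℝ} (hκ : Continuous κ)
    (hκM : ∀ x, |κ x| < M) : ∃ G : ℝ → ℝ, Continuous G ∧
      (∀ x, F (lineField v q κ x) = F v + κ x * G x) ∧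
      ∀ x, κ x = 0 → G x = ∑ l, partialD l F v * q l := by
  have hv : v ∈ U := by simpa using hq 0 (by simpa using hM)
  let H : ℝ → ℝ := fun y => F (v + y • q)
  have hd : HasDerivAt H (∑ l, partialD l F v * q l) 0 :=
    hasDerivAt_line (differentiableAt_of_smooth hU hF hv)
  have hc : ContinuousOn H (Ioo (-M) M) := fun y hy =>
    (((hF.contDiffAt (hU.mem_nhds (hq y (abs_lt.2 hy)))).continuousAt).comp
      (f := fun y : ℝ => v + y • q) (by fun_prop)).continuousWithinAt
  have hs := (continuousOn_dslope (Ioo_mem_nhds (neg_lt_zero.2 hM) hM)).2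
    ⟨hc, hd.differentiableAt⟩
  refine ⟨fun x => dslope H 0 (κ x), hs.comp_continuous hκ fun x => abs_lt.1 (hκM x),
    fun x => ?_, fun x hx => ?_⟩
  · have h := sub_smul_dslope H 0 (κ x)
    simp only [sub_zero, smul_eq_mul, H, zero_smul, add_zero] at h
    simp only [lineField, H, h]; ring
  · simp only [hx, dslope_same, hd.deriv]

/-- Skew-adjointness at the field `v`, with `ψ` locally linear, gives the symmetry of `g`; at a
field that is locally `v + x s q`, with `ψ` locally constant, it gives the derivative of `g`. -/
lemma skewCoeffs_of_isSkewAdjoint (hU : IsOpen U) (hg : SmoothMetric U g)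
    (hΓ : SmoothSymbols U Γ) (h : IsSkewAdjoint U (firstOrderOp g Γ)) : SkewCoeffs U g Γ := by
  -- the sum of the two pairings, with the derivatives moved off `φ = ρ f`, is the integral of `ρ`
  -- times the function whose value at `0` appears here
  have key : ∀ (u : Field1) (f : Pt) (ψ : Field1), IsFieldIn U u → IsTest ψ →
      ∑ i, f i * (firstOrderOp g Γ u ψ 0 i + ∑ j, ((∑ k, (Γ (u 0) j i k
        - partialD k (fun v => g v j i) (u 0)) * jet u 1 k 0) * ψ 0 j
        - g (u 0) j i * jet ψ 1 j 0)) = 0 := by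
    intro u f ψ hu hψ
    let E : ℝ → ℝ := fun x => ∑ i, f i * (firstOrderOp g Γ u ψ x i + ∑ j, ((∑ k, (Γ (u x) j i k
        - partialD k (fun v => g v j i) (u x)) * jet u 1 k x) * ψ x j
        - g (u x) j i * jet ψ 1 j x))
    have sψ := contDiff_firstOrderOp hU hg hΓ hu hψ.1
    have cj := continuous_jet hψ.1
    have cp := continuous_component hψ.1
    have cE : Continuous E := continuous_finsetSum _ fun i _ => continuous_const.mul
      ((continuous_component sψ i).add (continuous_finsetSum _ fun j _ =>
        ((continuous_finsetSum _ fun k _ => (((contDiff_along hU (hΓ j i k) hu).continuous.sub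
          (contDiff_along hU (contDiffOn_partialD hU (hg j i) k) hu).continuous).mul
          (continuous_jet hu.1 1 k))).mul (cp j)).sub
        ((contDiff_along hU (hg j i) hu).continuous.mul (cj 1 j))))
    have hz : Continuous fun _ : ℝ => (0 : ℝ) := continuous_const
    have := moments_eq_zero cE hz hz hz fun ρ hρ => ?_
    · have e0 : E 0 = 0 := by simpa using this
      exact e0
    have hφ := isTest_smul_const hρ f
    have sφ := contDiff_firstOrderOp hU hg hΓ hu hφ.1
    have e1 := h u _ ψ hu hφ hψ
    have e2 : pairing ψ (firstOrderOp g Γ u fun x => ρ x • f)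
        = ∫ x, (E x * ρ x - ∑ i, (ρ x • f) i * firstOrderOp g Γ u ψ x i) := by
      refine integral_eq_of_hasDerivAt (K := tsupport ρ)
        (S := fun x => ∑ i, ∑ j, g (u x) j i * (ρ x * f i * ψ x j)) hρ.hasCompactSupport
        ?_ ?_ ?_ ?_ ?_ ?_
      · exact continuous_finsetSum _ fun i _ => (cp i).mul (continuous_component sφ i)
      · exact (cE.mul hρ.1.continuous).sub (continuous_finsetSum _ fun i _ =>
          (continuous_component hφ.1 i).mul (continuous_component sψ i))
      · intro x hx
        simp [firstOrderOp_apply, jet_smul_const hρ.1, iteratedDeriv_eq_zero hx,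
          image_eq_zero_of_notMem_tsupport hx]
      · intro x hx; simp [image_eq_zero_of_notMem_tsupport hx]
      · intro x hx; simp [image_eq_zero_of_notMem_tsupport hx]
      · intro x
        have d0 : HasDerivAt ρ (iteratedDeriv 1 ρ x) x := by
          simpa using hasDerivAt_iteratedDeriv hρ.1 0 x
        refine HasDerivAt.congr_deriv (HasDerivAt.fun_sum fun i _ => HasDerivAt.fun_sum fun j _ =>
          (hasDerivAt_along hU (hg j i) hu x).mul ((d0.mul_const (f i)).mul
            (hasDerivAt_component hψ.1 j x))) ?_
        simp only [E, firstOrderOp_apply, jet_smul_const hρ.1, Fin.sum_univ_two, Pi.smul_apply,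
          smul_eq_mul]
        ring
    rw [e2, integral_sub, pairing] at e1
    · simp only [zero_mul, add_zero]
      linarith
    · exact (cE.mul hρ.1.continuous).integrable_of_hasCompactSupport hρ.hasCompactSupport.mul_left
    · exact (continuous_finsetSum _ fun i _ => (continuous_component hφ.1 i).mul
        (continuous_component sψ i)).integrable_of_hasCompactSupport
        (HasCompactSupport.intro hρ.hasCompactSupport fun x hx => by
          simp [image_eq_zero_of_notMem_tsupport hx])
  have hsym : ∀ v ∈ U, ∀ i j, g v i j = g v j i := by
    intro v hv i j
    obtain ⟨ψ, hψ, hj⟩ := exists_monomial_test 1 (Pi.single j 1)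
    have hj0 := hj 0 (by norm_num)
    have e := key (fun _ => v) (Pi.single i 1) ψ (isFieldIn_const hv) hψ
    have hψ0 : ∀ m, ψ 0 m = 0 := fun m => by
      rw [← congrFun (jet_zero ψ m) 0, hj0]; simp
    have hψ1 : ∀ m, jet ψ 1 m 0 = (Pi.single j 1 : Pt) m := fun m => by rw [hj0]; simp
    simp only [firstOrderOp_apply, hψ0, hψ1] at e
    fin_cases i <;> fin_cases j <;> simp at e ⊢ <;> linarith
  refine ⟨hsym, fun v hv i j k => ?_⟩
  obtain ⟨κ, M, hκ, hκ1, hM, hκM⟩ := exists_monomial_profile 1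
  obtain ⟨s, hs, hq⟩ := exists_scale hU hv (Pi.single k 1) hM
  obtain ⟨ψ, hψ, hj⟩ := exists_monomial_test 0 (Pi.single j 1)
  have hj0 := hj 0 (by norm_num)
  have e := key (lineField v (s • Pi.single k 1) κ) (Pi.single i 1) ψ
    (isFieldIn_lineField hκ hκM hq) hψ
  have hψ0 : ∀ m, ψ 0 m = (Pi.single j 1 : Pt) m := fun m => by
    rw [← congrFun (jet_zero ψ m) 0, hj0]; simp
  have hψ1 : ∀ m, jet ψ 1 m 0 = 0 := fun m => by rw [hj0]; simp
  have hκ0 : κ 0 = 0 := by simpa using hκ1 0 (by norm_num)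
  have hu0 : lineField v (s • Pi.single k 1) κ 0 = v := by simp [lineField, hκ0]
  have hd : iteratedDeriv 1 κ 0 = 1 := by
    have : κ =ᶠ[𝓝 0] fun x => x := Filter.mem_of_superset
      (Ioo_mem_nhds (by norm_num : (-1 : ℝ) < 0) one_pos) fun y hy => by simpa using hκ1 y hy
    rw [this.iteratedDeriv_eq 1]; simp
  have hu1 : ∀ l, jet (lineField v (s • Pi.single k 1) κ) 1 l 0 = s * (Pi.single k 1 : Pt) l :=
    fun l => by rw [jet_lineField, zero_add, hd]; simp
  have hgs : ∀ k, partialD k (fun w => g w 1 0) v = partialD k (fun w => g w 0 1) v := fun k => by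
    have : (fun w => g w 1 0) =ᶠ[𝓝 v] fun w => g w 0 1 :=
      Filter.mem_of_superset (hU.mem_nhds hv) fun w hw => hsym w hw 1 0
    rw [partialD, partialD, this.fderiv_eq]
  simp only [firstOrderOp_apply, hψ0, hψ1, hu0, hu1] at e
  have hs' := hs.ne'
  fin_cases i <;> fin_cases j <;> fin_cases k <;> simp [hgs] at e ⊢ <;>
    exact mul_left_cancel₀ hs' (by linarith)

end

section
variable {U : Set Pt} {g : Pt → Fin 2 → Fin 2 → ℝ} {Γ : Pt → Fin 2 → Fin 2 → Fin 2 → ℝ}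

/-- The third-order operator takes values in total derivatives. -/
lemma integral_thirdOrderOp (hU0 : ∀ v ∈ U, v 0 ≠ 0) {u φ : Field1} (hu : IsFieldIn U u)
    (hφ : IsTest φ) (k : Fin 2) : ∫ x, thirdOrderOp u φ x k = 0 := by
  have h0 : ∀ x, u x 0 ≠ 0 := fun x => hU0 _ (hu.2 x)
  have hc := continuous_component (contDiff_thirdOrderOp hu.1 h0 hφ.1)
  have hz : ∫ _ : ℝ, (0 : ℝ) = 0 := by simp
  rw [← hz]
  match k with
  | 0 =>
    refine integral_eq_of_hasDerivAt (K := tsupport φ) (S := fun x =>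
      recipJet u 1 x * jet φ 1 1 x + recipJet u 0 x * jet φ 2 1 x) hφ.2 (hc 0) continuous_const
      ?_ (fun _ _ => rfl) ?_ fun x => ?_
    · intro x hx; simp [thirdOrderOp_apply_zero hu.1 hφ.1 (h0 x), jet_eq_zero hx]
    · intro x hx; simp [jet_eq_zero hx]
    · refine (((hasDerivAt_recipJet_one hu.1 (h0 x)).mul (hasDerivAt_jet hφ.1 1 1 x)).add
        ((hasDerivAt_recipJet_zero hu.1 (h0 x)).mul (hasDerivAt_jet hφ.1 2 1 x))).congr_deriv ?_
      rw [thirdOrderOp_apply_zero hu.1 hφ.1 (h0 x)]; ring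
  | 1 =>
    refine integral_eq_of_hasDerivAt (K := tsupport φ) (S := fun x =>
      recipJet u 0 x * jet φ 2 0 x + 2 * (ratioJet u 0 x * jet φ 2 1 x)
        + ratioJet u 1 x * jet φ 1 1 x) hφ.2 (hc 1) continuous_const
      ?_ (fun _ _ => rfl) ?_ fun x => ?_
    · intro x hx; simp [thirdOrderOp_apply_one hu.1 hφ.1 (h0 x), jet_eq_zero hx]
    · intro x hx; simp [jet_eq_zero hx]
    · refine ((((hasDerivAt_recipJet_zero hu.1 (h0 x)).mul (hasDerivAt_jet hφ.1 2 0 x)).add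
        (((hasDerivAt_ratioJet_zero hu.1 (h0 x)).mul (hasDerivAt_jet hφ.1 2 1 x)).const_mul
        2)).add ((hasDerivAt_ratioJet_one hu.1 (h0 x)).mul
        (hasDerivAt_jet hφ.1 1 1 x))).congr_deriv ?_
      rw [thirdOrderOp_apply_one hu.1 hφ.1 (h0 x)]; ring

/-- The symmetry of `Γʲⁱₖ gᵏᵐ` in `j, m`: the bracket `[P, P]` at a constant field, with `ψ` locally
constant and `χ` locally quadratic. -/
lemma symbols_mul_metric_of_schoutenCommute (hU : IsOpen U) (hg : SmoothMetric U g)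
    (hΓ : SmoothSymbols U Γ) (hs : SkewCoeffs U g Γ)
    (h : SchoutenCommute U (firstOrderOp g Γ) (firstOrderOp g Γ)) {v : Pt} (hv : v ∈ U)
    (i : Fin 2) :
    ∑ k, Γ v 0 i k * g v k 1 = ∑ k, Γ v 1 i k * g v k 0 := by
  obtain ⟨ψ, hψ, jψ⟩ := exists_monomial_test 0 (Pi.single i 1)
  obtain ⟨χ, hχ, jχ⟩ := exists_monomial_test 2 (Pi.single 1 1)
  have hz : Continuous fun _ : ℝ => (0 : ℝ) := continuous_const
  have hK : Continuous fun _ : ℝ => 2 * (∑ k, Γ v 0 i k * g v k 1 - ∑ k, Γ v 1 i k * g v k 0) :=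
    continuous_const
  have key := moments_eq_zero hz hK hz hz fun ρ hρ => ?_
  · linarith
  have hφ := isTest_smul_const hρ (Pi.single 0 1)
  have e := h (fun _ => v) _ ψ χ (isFieldIn_const hv) hφ hψ hχ
  rw [schouten_first_first hU hg hΓ hs (isFieldIn_const hv) hφ hψ hχ] at e
  refine Eq.trans ?_ ((mul_eq_zero.1 e).resolve_left two_ne_zero)
  congr 1
  funext x
  by_cases hx : x ∈ Ioo (-1 : ℝ) 1
  · have hψ0 : ∀ m, ψ x m = (Pi.single i 1 : Pt) m := fun m => by
      rw [← congrFun (jet_zero ψ m) x, jψ x hx]; simp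
    have hχ0 : ∀ m, χ x m = x ^ 2 * (Pi.single 1 1 : Pt) m := fun m => by
      rw [← congrFun (jet_zero χ m) x, jχ x hx]; simp
    simp only [firstDensity, firstForm, firstOrderOp_apply, jet_smul_const hρ.1, jψ x hx, jχ x hx,
      jet_const, hψ0, hχ0, Fin.sum_univ_two]
    fin_cases i <;> simp [Nat.descFactorial] <;> ring
  · have hx' : x ∉ tsupport ρ := fun hm => hx (hρ.2 hm)
    simp [firstDensity, firstForm, firstOrderOp_apply, jet_smul_const hρ.1,
      iteratedDeriv_eq_zero hx', image_eq_zero_of_notMem_tsupport hx']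

lemma thirdOrderOp_const {v : Pt} (h0 : v 0 ≠ 0) {ψ : Field1} (hψ : ContDiff ℝ ∞ ψ) (x : ℝ) :
    thirdOrderOp (fun _ => v) ψ x 0 = (v 0)⁻¹ * jet ψ 3 1 x ∧
    thirdOrderOp (fun _ => v) ψ x 1 = (v 0)⁻¹ * jet ψ 3 0 x
      + 2 * v 1 * (v 0)⁻¹ ^ 2 * jet ψ 3 1 x := by
  rw [thirdOrderOp_apply_zero contDiff_const hψ h0, thirdOrderOp_apply_one contDiff_const hψ h0]
  simp only [recipJet, ratioJet, jet_const]
  constructor <;> ring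

/-- The bracket `[P, R]` at a constant field, with `ψ` locally constant and `χ` locally quartic. -/
lemma symbols_relation_of_quartic (hU : IsOpen U) (hU0 : ∀ v ∈ U, v 0 ≠ 0) (hg : SmoothMetric U g)
    (hΓ : SmoothSymbols U Γ) (hs : SkewCoeffs U g Γ)
    (h : SchoutenCommute U (firstOrderOp g Γ) thirdOrderOp) {v : Pt} (hv : v ∈ U) (i : Fin 2) :
    Γ v 0 i 0 + 2 * v 1 * (v 0)⁻¹ * Γ v 0 i 1 = Γ v 1 i 1 := by
  have h0 := hU0 v hv
  obtain ⟨ψ, hψ, jψ⟩ := exists_monomial_test 0 (Pi.single i 1)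
  obtain ⟨χ, hχ, jχ⟩ := exists_monomial_test 4 (Pi.single 1 1)
  have hz : Continuous fun _ : ℝ => (0 : ℝ) := continuous_const
  have hK1 : Continuous fun _ : ℝ => 24 * (Γ v 0 i 0 * (v 0)⁻¹
    + Γ v 0 i 1 * (2 * v 1 * (v 0)⁻¹ ^ 2)) := continuous_const
  have hK3 : Continuous fun _ : ℝ => -4 * (Γ v 1 i 1 * (v 0)⁻¹) := continuous_const
  have key := moments_eq_zero hz hK1 hz hK3 fun ρ hρ => ?_
  · field_simp at key ⊢
    linear_combination -key / 24
  have hφ := isTest_smul_const hρ (Pi.single 0 1)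
  have e := h (fun _ => v) _ ψ χ (isFieldIn_const hv) hφ hψ hχ
  rw [schouten_first_third hU hU0 hg hΓ hs (isFieldIn_const hv) hφ hψ hχ] at e
  refine Eq.trans ?_ e
  congr 1
  funext x
  have t1 := fun x => thirdOrderOp_const h0 hφ.1 x
  have t2 := fun x => thirdOrderOp_const h0 hψ.1 x
  have t3 := fun x => thirdOrderOp_const h0 hχ.1 x
  by_cases hx : x ∈ Ioo (-1 : ℝ) 1
  · have hψ0 : ∀ m, ψ x m = (Pi.single i 1 : Pt) m := fun m => by
      rw [← congrFun (jet_zero ψ m) x, jψ x hx]; simp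
    have hχ0 : ∀ m, χ x m = x ^ 4 * (Pi.single 1 1 : Pt) m := fun m => by
      rw [← congrFun (jet_zero χ m) x, jχ x hx]; simp
    simp only [mixedDensity, firstForm, thirdForm, firstOrderOp_apply, t1, t2, t3,
      jet_smul_const hρ.1, jψ x hx, jχ x hx, jet_const, hψ0, hχ0, Fin.sum_univ_two]
    fin_cases i <;> simp [Nat.descFactorial] <;> ring
  · have hx' : x ∉ tsupport ρ := fun hm => hx (hρ.2 hm)
    simp [mixedDensity, firstForm, thirdForm, firstOrderOp_apply, jet_smul_const hρ.1,
      iteratedDeriv_eq_zero hx', image_eq_zero_of_notMem_tsupport hx', t1]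

/-- The bracket `[P, R]` at a constant field, with `ψ` and `χ` locally quadratic. -/
lemma symbols_relation_of_quadratic (hU : IsOpen U) (hU0 : ∀ v ∈ U, v 0 ≠ 0)
    (hg : SmoothMetric U g) (hΓ : SmoothSymbols U Γ) (hs : SkewCoeffs U g Γ)
    (h : SchoutenCommute U (firstOrderOp g Γ) thirdOrderOp) {v : Pt} (hv : v ∈ U) :
    Γ v 1 0 1 - Γ v 0 1 1 = (v 0)⁻¹ * g v 0 0 ∧ Γ v 0 1 0 - Γ v 1 0 0 = (v 0)⁻¹ * g v 0 1 := by
  have h0 := hU0 v hv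
  obtain ⟨ψ, hψ, jψ⟩ := exists_monomial_test 2 (Pi.single 1 1)
  obtain ⟨χ, hχ, jχ⟩ := exists_monomial_test 2 (Pi.single 0 1)
  have hz : Continuous fun _ : ℝ => (0 : ℝ) := continuous_const
  -- `a = 1/u¹`, `b = u²/(u¹)²`
  have main : ∀ (f : Pt) (a b : ℝ), a = (v 0)⁻¹ → b = v 1 * (v 0)⁻¹ ^ 2 →
      -(4 * a ^ 2 * f 1 * g v 0 1 - 8 * a * b * f 1 * g v 0 0 + 4 * a ^ 2 * f 1 * g v 1 0
        - 4 * a ^ 2 * (g v 0 0 * f 0 + g v 0 1 * f 1))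
      + 2 * (4 * a ^ 2 * f 0 * g v 0 0 + 8 * a * b * f 1 * g v 0 0 - 4 * a ^ 2 * f 1 * g v 1 0)
      - 6 * (2 * (Γ v 1 0 0 - Γ v 0 1 0) * a * f 1
        + 2 * (Γ v 1 0 1 - Γ v 0 1 1) * (a * f 0 + 2 * b * f 1)) = 0 := by
    intro f a b ha hb
    have hK1 : Continuous fun _ : ℝ => (4 * a ^ 2 * f 1 * g v 0 1 - 8 * a * b * f 1 * g v 0 0
        + 4 * a ^ 2 * f 1 * g v 1 0 - 4 * a ^ 2 * (g v 0 0 * f 0 + g v 0 1 * f 1)) :=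
      continuous_const
    have hK2 : Continuous fun _ : ℝ => (4 * a ^ 2 * f 0 * g v 0 0 + 8 * a * b * f 1 * g v 0 0
        - 4 * a ^ 2 * f 1 * g v 1 0) := continuous_const
    have hK3 : Continuous fun _ : ℝ => (2 * (Γ v 1 0 0 - Γ v 0 1 0) * a * f 1
        + 2 * (Γ v 1 0 1 - Γ v 0 1 1) * (a * f 0 + 2 * b * f 1)) := continuous_const
    have key := moments_eq_zero hz hK1 hK2 hK3 fun ρ hρ => ?_
    · linarith
    have hφ := isTest_smul_const hρ f
    have e := h (fun _ => v) _ ψ χ (isFieldIn_const hv) hφ hψ hχ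
    rw [schouten_first_third hU hU0 hg hΓ hs (isFieldIn_const hv) hφ hψ hχ] at e
    refine Eq.trans ?_ e
    congr 1
    funext x
    have t1 := fun x => thirdOrderOp_const h0 hφ.1 x
    have t2 := fun x => thirdOrderOp_const h0 hψ.1 x
    have t3 := fun x => thirdOrderOp_const h0 hχ.1 x
    by_cases hx : x ∈ Ioo (-1 : ℝ) 1
    · have hψ0 : ∀ m, ψ x m = x ^ 2 * (Pi.single 1 1 : Pt) m := fun m => by
        rw [← congrFun (jet_zero ψ m) x, jψ x hx]; simp
      have hχ0 : ∀ m, χ x m = x ^ 2 * (Pi.single 0 1 : Pt) m := fun m => by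
        rw [← congrFun (jet_zero χ m) x, jχ x hx]; simp
      simp only [mixedDensity, firstForm, thirdForm, firstOrderOp_apply, t1, t2, t3,
        jet_smul_const hρ.1, jψ x hx, jχ x hx, jet_const, hψ0, hχ0, Fin.sum_univ_two]
      rw [ha, hb]
      simp [Nat.descFactorial]
      ring
    · have hx' : x ∉ tsupport ρ := fun hm => hx (hρ.2 hm)
      simp [mixedDensity, firstForm, thirdForm, firstOrderOp_apply, jet_smul_const hρ.1,
        iteratedDeriv_eq_zero hx', image_eq_zero_of_notMem_tsupport hx', t1]
  have ha : (v 0)⁻¹ ≠ 0 := inv_ne_zero h0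
  have m0 := main (Pi.single 0 1) _ _ rfl rfl
  have m1 := main (Pi.single 1 1) _ _ rfl rfl
  rw [hs.1 v hv 1 0] at m1
  simp at m0 m1
  have c1 : Γ v 1 0 1 - Γ v 0 1 1 = (v 0)⁻¹ * g v 0 0 :=
    mul_left_cancel₀ ha (by linear_combination -m0 / 12)
  refine ⟨c1, (eq_inv_mul_iff_mul_eq₀ h0).2 (mul_left_cancel₀ h0 ?_)⟩
  field_simp at m1 c1
  linear_combination m1 / 12 + 2 * v 1 * c1

/-- The bracket `[P, R]` at a field that is locally `v + x³ q`, with `ψ` locally constant and `χ`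
locally linear. -/
lemma symbols_derivative_relation (hU : IsOpen U) (hU0 : ∀ v ∈ U, v 0 ≠ 0) (hg : SmoothMetric U g)
    (hΓ : SmoothSymbols U Γ) (hs : SkewCoeffs U g Γ)
    (h : SchoutenCommute U (firstOrderOp g Γ) thirdOrderOp) {v : Pt} (hv : v ∈ U)
    (f k l q : Pt) (a : ℝ) (ha : a = (v 0)⁻¹) :
    l 1 * (-(a ^ 2 * f 0 + 2 * v 1 * a ^ 3 * f 1) * (∑ j, ∑ m, Γ v 0 j m * q m * k j)
      + a ^ 2 * f 1 * (∑ j, ∑ m, Γ v 1 j m * q m * k j)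
      + a ^ 2 * q 0 * (∑ i, ∑ j, Γ v j i 0 * k i * f j)
      - (q 1 * a ^ 2 - 2 * v 1 * a ^ 3 * q 0) * (∑ i, ∑ j, Γ v j i 1 * k i * f j))
    - (∑ i, ∑ j, l i * k j * ∑ m, q m * (3 * partialD 0 (fun v => Γ v i j m) v
        - 4 * partialD m (fun v => Γ v i j 0) v)) * (a * f 1)
    - (∑ i, ∑ j, l i * k j * ∑ m, q m * (3 * partialD 1 (fun v => Γ v i j m) v
        - 4 * partialD m (fun v => Γ v i j 1) v)) * (a * f 0 + 2 * v 1 * a ^ 2 * f 1) = 0 := by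
  obtain ⟨κ, M, hκ, hκ3, hM, hκM⟩ := exists_monomial_profile 3
  obtain ⟨s, hs0, hq⟩ := exists_scale hU hv q hM
  obtain ⟨ψ, hψ, jψ⟩ := exists_monomial_test 0 k
  obtain ⟨χ, hχ, jχ⟩ := exists_monomial_test 1 l
  set p : Pt := s • q with hp
  set u := lineField v p κ with hu_def
  have hu : IsFieldIn U u := isFieldIn_lineField hκ hκM hq
  have h0 : ∀ x, u x 0 ≠ 0 := fun x => hU0 _ (hu.2 x)
  have hκ0 : κ 0 = 0 := by simpa using hκ3 0 (by norm_num)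
  have hu0 : u 0 = v := by simp [hu_def, lineField, hκ0]
  choose G hGc hG hG0 using fun i j m =>
    exists_quotient hU (hΓ i j m) hM hq hκ.continuous hκM
  let A : ℝ → ℝ := fun x => (u x 0)⁻¹
  let w : ℝ → ℝ := fun x => u x 1
  let S : Fin 2 → Fin 2 → Fin 2 → ℝ → ℝ := fun i j m x => Γ (u x) i j m
  let D : Fin 2 → Fin 2 → Fin 2 → Fin 2 → ℝ → ℝ := fun i j m n x =>
    partialD m (fun v => Γ v i j n) (u x)
  have cA : Continuous A := (continuous_component hu.1 0).inv₀ h0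
  have cw : Continuous w := continuous_component hu.1 1
  have cS : ∀ i j m, Continuous (S i j m) := fun i j m =>
    (contDiff_along hU (hΓ i j m) hu).continuous
  have cD : ∀ i j m n, Continuous (D i j m n) := fun i j m n =>
    (contDiff_along hU (contDiffOn_partialD hU (hΓ i j n) m) hu).continuous
  -- `x α, x β` are the second derivatives of `1/u¹` and `u²/(u¹)²`, and `x² α', x² β'` the first
  let α : ℝ → ℝ := fun x => 18 * A x ^ 3 * x ^ 3 * p 0 ^ 2 - 6 * A x ^ 2 * p 0
  let β : ℝ → ℝ := fun x => 6 * p 1 * A x ^ 2 - 36 * x ^ 3 * p 1 * p 0 * A x ^ 3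
    + 54 * w x * A x ^ 4 * x ^ 3 * p 0 ^ 2 - 12 * w x * A x ^ 3 * p 0
  let α' : ℝ → ℝ := fun x => -3 * A x ^ 2 * p 0
  let β' : ℝ → ℝ := fun x => 3 * p 1 * A x ^ 2 - 6 * w x * A x ^ 3 * p 0
  have cα : Continuous α := by fun_prop
  have cβ : Continuous β := by fun_prop
  have cα' : Continuous α' := by fun_prop
  have cβ' : Continuous β' := by fun_prop
  let C : Fin 2 → Fin 2 → Fin 2 → ℝ → ℝ := fun i j m x => ∑ n, (D i j m n x - D i j n m x) * p n
  have cC : ∀ i j m, Continuous (C i j m) := fun i j m => continuous_finsetSum _ fun n _ =>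
    ((cD i j m n).sub (cD i j n m)).mul continuous_const
  let μ : Fin 2 → ℝ → ℝ := fun m x => ∑ i, ∑ j, l i * k j * (3 * C i j m x - G i j m x)
  have cμ : ∀ m, Continuous (μ m) := fun m => continuous_finsetSum _ fun i _ =>
    continuous_finsetSum _ fun j _ => continuous_const.mul
      ((continuous_const.mul (cC i j m)).sub (hGc i j m))
  let Q : Fin 2 → ℝ → ℝ := fun i x => ∑ j, ∑ m, S i j m x * p m * k j
  have cQ : ∀ i, Continuous (Q i) := fun i => continuous_finsetSum _ fun j _ =>
    continuous_finsetSum _ fun m _ => ((cS i j m).mul continuous_const).mul continuous_const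
  let T : Fin 2 → ℝ → ℝ := fun m x => ∑ i, ∑ j, S j i m x * k i * f j
  have cT : ∀ m, Continuous (T m) := fun m => continuous_finsetSum _ fun i _ =>
    continuous_finsetSum _ fun j _ => ((cS j i m).mul continuous_const).mul continuous_const
  let V : Fin 2 → ℝ → ℝ := fun m x => ∑ i, ∑ j, C i j m x * k i * f j
  have cV : ∀ m, Continuous (V m) := fun m => continuous_finsetSum _ fun i _ =>
    continuous_finsetSum _ fun j _ => ((cC i j m).mul continuous_const).mul continuous_const
  have hK0 : Continuous fun x => 3 * x ^ 3 * l 1 * (V 0 x * α x + V 1 x * β x) := by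
    have := cV 0; have := cV 1; fun_prop
  have hK1 : Continuous fun x => l 1 * (T 0 x * α x + T 1 x * β x)
      + x ^ 3 * (μ 0 x * α x * f 1 + μ 1 x * β x * f 1) := by
    have := cT 0; have := cT 1; have := cμ 0; have := cμ 1; fun_prop
  have hK2 : Continuous fun x => 3 * l 1 * (-(A x ^ 2 * f 0 + 2 * w x * A x ^ 3 * f 1) * Q 0 x
      + A x ^ 2 * f 1 * Q 1 x) + x ^ 3 * (2 * μ 0 x * α' x * f 1
      + μ 1 x * (α' x * f 0 + 3 * β' x * f 1)) := by
    have := cQ 0; have := cQ 1; have := cμ 0; have := cμ 1; fun_prop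
  have hK3 : Continuous fun x => μ 0 x * (A x * f 1)
      + μ 1 x * (A x * f 0 + 2 * w x * A x ^ 2 * f 1) := by
    have := cμ 0; have := cμ 1; fun_prop
  have key := moments_eq_zero hK0 hK1 hK2 hK3 fun ρ hρ => ?_
  · have hA0 : A 0 = a := by simp only [A, hu0, ha]
    have hw0 : w 0 = v 1 := by simp only [w, hu0]
    have hp' : ∀ m, p m = s * q m := fun m => rfl
    simp only [α, β, α', β', V, T, Q, μ, C, S, D, hG0 _ _ _ 0 hκ0, hA0, hw0, hu0, hp',
      Fin.sum_univ_two] at key ⊢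
    refine (mul_eq_zero.1 (?_ : (6 * s) * _ = 0)).resolve_left (by positivity)
    linear_combination key
  have hφ := isTest_smul_const hρ f
  have e := h u _ ψ χ hu hφ hψ hχ
  rw [schouten_first_third hU hU0 hg hΓ hs hu hφ hψ hχ] at e
  have cR := contDiff_thirdOrderOp hu.1 h0 hφ.1
  have iR : ∀ m (c : ℝ), Integrable fun x => c * thirdOrderOp u (fun x => ρ x • f) x m :=
    fun m c => ((continuous_component cR m).integrable_of_hasCompactSupport
      (HasCompactSupport.intro hφ.2 fun x hx => by
        match m with
        | 0 => simp [thirdOrderOp_apply_zero hu.1 hφ.1 (h0 x), jet_eq_zero hx]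
        | 1 => simp [thirdOrderOp_apply_one hu.1 hφ.1 (h0 x), jet_eq_zero hx])).const_mul c
  have zR : ∀ m (c : ℝ), ∫ x, c * thirdOrderOp u (fun x => ρ x • f) x m = 0 := fun m c => by
    rw [integral_const_mul, integral_thirdOrderOp hU0 hu hφ, mul_zero]
  obtain ⟨c, hc⟩ : ∃ c : Fin 2 → ℝ, ∀ m, c m = ∑ i, ∑ j, Γ v i j m * l i * k j :=
    ⟨_, fun _ => rfl⟩
  -- `M(χ, ψ)` has the constant term `-c`, which contributes nothing as `∫ R φ dx = 0`; adding
  -- `c·Rφ` to the density makes it of the form required by `moments_eq_zero`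
  have e' := integral_add_add (((integrable_mixedDensity hU hU0 hg hΓ hu hφ hψ hχ).add
    (integrable_mixedDensity hU hU0 hg hΓ hu hψ hχ hφ)).add
    (integrable_mixedDensity hU hU0 hg hΓ hu hχ hφ hψ))
    (iR 0 (c 0)) (iR 1 (c 1))
  rw [zR, zR, add_zero, add_zero] at e'
  refine Eq.trans ?_ (e'.trans e)
  congr 1
  funext x
  simp only [Pi.add_apply]
  by_cases hx : x ∈ Ioo (-1 : ℝ) 1
  · have hψ0 : ∀ m, ψ x m = k m := fun m => by
      rw [← congrFun (jet_zero ψ m) x, jψ x hx]; simp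
    have hχ0 : ∀ m, χ x m = x * l m := fun m => by
      rw [← congrFun (jet_zero χ m) x, jχ x hx]; simp
    have hd : ∀ n, iteratedDeriv n κ x = Nat.descFactorial 3 n * x ^ (3 - n) := fun n => by
      have : κ =ᶠ[𝓝 x] fun x => x ^ 3 := Filter.mem_of_superset (Ioo_mem_nhds hx.1 hx.2) hκ3
      rw [this.iteratedDeriv_eq n, iteratedDeriv_pow]
    have u1 : ∀ m, jet u 1 m x = 3 * x ^ 2 * p m := fun m => by
      rw [hu_def, jet_lineField, hd]; norm_num [Nat.descFactorial]
    have u2 : ∀ m, jet u 2 m x = 6 * x * p m := fun m => by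
      rw [hu_def, jet_lineField, hd]; norm_num [Nat.descFactorial]
    have ψn : ∀ n m, jet ψ (n + 1) m x = 0 := fun n m => by
      rw [jψ x hx]; simp
    have χ1 : ∀ m, jet χ 1 m x = l m := fun m => by rw [jχ x hx]; simp
    have χn : ∀ n m, jet χ (n + 2) m x = 0 := fun n m => by
      rw [jχ x hx]; simp [Nat.descFactorial]
    have hΓx : ∀ i j m, Γ (u x) i j m = Γ v i j m + x ^ 3 * G i j m x := fun i j m => by
      rw [← hκ3 x hx]; exact hG i j m x
    have a1 : recipJet u 1 x = x ^ 2 * α' x := by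
      simp only [recipJet, α', A, u1]; ring
    have a2 : recipJet u 2 x = x * α x := by
      simp only [recipJet, α, A, u1, u2]; ring
    have b1 : ratioJet u 1 x = x ^ 2 * β' x := by
      simp only [ratioJet, β', A, w, u1]; ring
    have b2 : ratioJet u 2 x = x * β x := by
      simp only [ratioJet, β, A, w, u1, u2]; ring
    have a0 : recipJet u 0 x = A x := rfl
    have b0 : ratioJet u 0 x = w x * A x ^ 2 := rfl
    have φn : ∀ n m, jet (fun x => ρ x • f) n m x = iteratedDeriv n ρ x * f m := fun n m =>
      jet_smul_const hρ.1 f n m x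
    have Pψ : ∀ i, firstOrderOp g Γ u ψ x i = 3 * x ^ 2 * Q i x := fun i => by
      simp only [firstOrderOp_apply, ψn 0, hψ0, u1, Q, S, Fin.sum_univ_two]; ring
    have Rψ : ∀ m, thirdOrderOp u ψ x m = 0 := fun m => by
      match m with
      | 0 => simp [thirdOrderOp_apply_zero hu.1 hψ.1 (h0 x), ψn 0, ψn 1, ψn 2]
      | 1 => simp [thirdOrderOp_apply_one hu.1 hψ.1 (h0 x), ψn 0, ψn 1, ψn 2]
    have Rχ0 : thirdOrderOp u χ x 0 = x * α x * l 1 := by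
      rw [thirdOrderOp_apply_zero hu.1 hχ.1 (h0 x), χ1, χn 0, χn 1, a2]; ring
    have Rχ1 : thirdOrderOp u χ x 1 = x * β x * l 1 := by
      rw [thirdOrderOp_apply_one hu.1 hχ.1 (h0 x), χ1, χn 0, χn 1, χn 0, χn 1, b2]; ring
    have N₂ : ∀ m, thirdForm u ψ (fun x => ρ x • f) x m = 0 := fun m => by
      match m with
      | 0 => simp [thirdForm, ψn 0, ψn 1]
      | 1 => simp [thirdForm, ψn 0, ψn 1]
    have N₃ : ∀ m, thirdForm u χ ψ x m = 0 := fun m => by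
      match m with
      | 0 => simp [thirdForm, ψn 0, ψn 1]
      | 1 => simp [thirdForm, ψn 0, ψn 1]
    have M₂ : ∀ m, firstForm Γ u ψ (fun x => ρ x • f) x m
        = T m x * iteratedDeriv 1 ρ x + 3 * x ^ 2 * V m x * ρ x := fun m => by
      simp only [firstForm, ψn 0, hψ0, φn, u1, T, V, C, S, D, Fin.sum_univ_two, Pi.smul_apply,
        smul_eq_mul]
      ring
    have M₃ : ∀ m, firstForm Γ u χ ψ x m
        = x ^ 3 * μ m x - c m := fun m => by
      simp only [hc, firstForm, ψn 0, hψ0, χ1, hχ0, u1, μ, C, D, hΓx, Fin.sum_univ_two]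
      ring
    have N₁0 : thirdForm u (fun x => ρ x • f) χ x 0
        = -(A x ^ 2 * f 0 + 2 * w x * A x ^ 3 * f 1) * l 1 * iteratedDeriv 2 ρ x := by
      simp only [thirdForm, Matrix.cons_val_zero, φn, χ1, χn 0, A, w]; ring
    have N₁1 : thirdForm u (fun x => ρ x • f) χ x 1
        = A x ^ 2 * f 1 * l 1 * iteratedDeriv 2 ρ x := by
      simp only [thirdForm, Matrix.cons_val_one, Matrix.cons_val_fin_one, φn, χ1, χn 0, A]; ring
    simp only [mixedDensity, Fin.sum_univ_two, Pψ, Rψ, Rχ0, Rχ1, N₂, N₃, M₂, M₃,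
      N₁0, N₁1, thirdOrderOp_apply_zero hu.1 hφ.1 (h0 x), thirdOrderOp_apply_one hu.1 hφ.1 (h0 x),
      φn, a0, a1, a2, b0, b1, b2]
    ring
  · have hx' : x ∉ tsupport ρ := fun hm => hx (hρ.2 hm)
    simp [mixedDensity, firstForm, thirdForm, firstOrderOp_apply, jet_smul_const hρ.1,
      iteratedDeriv_eq_zero hx', image_eq_zero_of_notMem_tsupport hx',
      thirdOrderOp_apply_zero hu.1 hφ.1 (h0 x), thirdOrderOp_apply_one hu.1 hφ.1 (h0 x)]

end

/-! ### Integration of the pointwise relations -/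

variable {U : Set Pt} {g : Pt → Fin 2 → Fin 2 → ℝ} {Γ : Pt → Fin 2 → Fin 2 → Fin 2 → ℝ}

lemma exists_eq_const_of_partials (hU : IsOpen U) (hUc : IsConnected U) {f : Pt → ℝ}
    (hf : ∀ v ∈ U, ∃ d, HasPartials f d v ∧ ∀ k, d k = 0) : ∃ c, ∀ v ∈ U, f v = c := by
  refine hU.exists_is_const_of_fderiv_eq_zero hUc.isPreconnected
    (fun v hv => (hf v hv).choose_spec.1.1.differentiableWithinAt) fun v hv => ?_
  obtain ⟨d, hd, h0⟩ := hf v hv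
  ext w
  simp [fderiv_apply_eq, hd.2, h0]

lemma hasPartials_of_smooth {f : Pt → ℝ} (hU : IsOpen U) (hf : ContDiffOn ℝ ∞ f U) {v : Pt}
    (hv : v ∈ U) : HasPartials f (fun k => partialD k f v) v :=
  ⟨differentiableAt_of_smooth hU hf hv, fun _ => rfl⟩

/-- An affine function of `u¹` that vanishes on a nonempty open set has zero coefficients. -/
lemma eq_zero_of_affine (hU : IsOpen U) (hne : U.Nonempty) {r s : ℝ}
    (h : ∀ v ∈ U, r + v 0 * s = 0) : r = 0 ∧ s = 0 := by
  obtain ⟨v, hv⟩ := hne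
  have hc : Continuous fun t : ℝ => v + t • (Pi.single 0 1 : Pt) := by fun_prop
  have hn : ∀ᶠ t in 𝓝[≠] (0 : ℝ), v + t • (Pi.single 0 1 : Pt) ∈ U :=
    nhdsWithin_le_nhds (hc.continuousAt.eventually_mem (hU.mem_nhds (by simpa using hv)))
  obtain ⟨t, ht, ht0⟩ := (hn.and self_mem_nhdsWithin).exists
  have e := h _ ht
  have e' := h v hv
  simp only [Pi.add_apply, Pi.smul_apply, Pi.single_eq_same, smul_eq_mul, mul_one] at e
  have hs : s = 0 := (mul_eq_zero.1 (by linear_combination e - e' : t * s = 0)).resolve_left ht0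
  exact ⟨by simpa [hs] using e', hs⟩

/-- The first-order relations on `Γ` contained in `[P, R] = 0`, solved for the partial derivatives:
`Γ¹ʲₘ` is locally constant and the gradient of `Γ²ʲ₁` is determined algebraically. -/
lemma partialD_symbols (hU : IsOpen U) (hU0 : ∀ v ∈ U, v 0 ≠ 0) (hg : SmoothMetric U g)
    (hΓ : SmoothSymbols U Γ) (hs : SkewCoeffs U g Γ)
    (h : SchoutenCommute U (firstOrderOp g Γ) thirdOrderOp) {v : Pt} (hv : v ∈ U) (j : Fin 2) :
    (∀ m k, partialD k (fun v => Γ v 0 j m) v = 0) ∧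
    v 0 * partialD 0 (fun v => Γ v 1 j 0) v = 2 * v 1 * (v 0)⁻¹ * (Γ v 0 j 0 - Γ v 1 j 1)
      - 2 * Γ v 1 j 0 + 4 * v 1 ^ 2 * (v 0)⁻¹ ^ 2 * Γ v 0 j 1 ∧
    partialD 1 (fun v => Γ v 1 j 0) v = -2 * v 1 * (v 0)⁻¹ ^ 2 * Γ v 0 j 1 := by
  have h0 := hU0 v hv
  obtain ⟨a, ha⟩ : ∃ a, a = (v 0)⁻¹ := ⟨_, rfl⟩
  have ha0 : a ≠ 0 := ha ▸ inv_ne_zero h0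
  have E := fun f l q : Fin 2 => symbols_derivative_relation hU hU0 hg hΓ hs h hv
    (Pi.single f 1) (Pi.single j 1) (Pi.single l 1) (Pi.single q 1) a ha
  have E000 := E 0 0 0
  have E001 := E 0 0 1
  have E100 := E 1 0 0
  have E101 := E 1 0 1
  have E010 := E 0 1 0
  have E011 := E 0 1 1
  have E110 := E 1 1 0
  have E111 := E 1 1 1
  rw [← ha]
  have hb : v 0 * a = 1 := by rw [ha, mul_inv_cancel₀ h0]
  clear E ha
  simp [Pi.single_apply, ha0] at E000 E001 E100 E101 E010 E011 E110 E111
  refine ⟨fun m k => mul_left_cancel₀ ha0 ?_, mul_left_cancel₀ ha0 ?_, mul_left_cancel₀ ha0 ?_⟩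
  · match m, k with
    | 0, 0 => linear_combination E100 + 2 * v 1 * a ^ 2 * E000
    | 0, 1 => linear_combination -(3 * a * E000 - 4 * E101 - 8 * v 1 * a ^ 2 * E001) / 7
    | 1, 0 => linear_combination -(4 * a * E000 - 3 * E101 - 6 * v 1 * a ^ 2 * E001) / 7
    | 1, 1 => linear_combination -a * E001
  · linear_combination v 0 * E110 - 2 * v 1 * a * v 0 * E010
      - a * (2 * Γ v 1 j 0 - 2 * v 1 * a * (Γ v 0 j 0 - Γ v 1 j 1)
        - 4 * v 1 ^ 2 * a ^ 2 * Γ v 0 j 1) * hb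
  · linear_combination (3 * E010 + 4 * E111 - 8 * v 1 * a * E011) / 7

/-- A Hamiltonian operator `P` with `[P, R] = 0` has rational form. -/
lemma exists_isRational (hU : IsOpen U) (hUc : IsConnected U) (hU0 : ∀ v ∈ U, v 0 ≠ 0)
    (hg : SmoothMetric U g) (hΓ : SmoothSymbols U Γ) (hH : IsHamiltonian U (firstOrderOp g Γ))
    (hR : SchoutenCommute U (firstOrderOp g Γ) thirdOrderOp) :
    ∃ c₁ c₂ c₃ c₄ c₅ c₆, IsRational U g Γ c₁ c₂ c₃ c₄ c₅ c₆ := by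
  have hs := skewCoeffs_of_isSkewAdjoint hU hg hΓ hH.1
  have pde := fun {v} (hv : v ∈ U) => partialD_symbols hU hU0 hg hΓ hs hR hv
  have const : ∀ j m, ∃ c, ∀ v ∈ U, Γ v 0 j m = c := fun j m =>
    exists_eq_const_of_partials hU hUc fun v hv =>
      ⟨_, hasPartials_of_smooth hU (hΓ 0 j m) hv, (pde hv j).1 m⟩
  -- in the end `p = c₁ / 2`, `q = c₂ / 2` and `r = -c₁ / 2`
  obtain ⟨p, hp⟩ := const 0 0
  obtain ⟨q, hq⟩ := const 0 1
  obtain ⟨c₄, h₄⟩ := const 1 0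
  obtain ⟨r, hr⟩ := const 1 1
  have rel := fun {v} (hv : v ∈ U) => symbols_relation_of_quadratic hU hU0 hg hΓ hs hR hv
  have Γ101 : ∀ v ∈ U, Γ v 1 0 1 = p + 2 * v 1 * (v 0)⁻¹ * q := fun v hv => by
    rw [← symbols_relation_of_quartic hU hU0 hg hΓ hs hR hv 0, hp v hv, hq v hv]
  have Γ111 : ∀ v ∈ U, Γ v 1 1 1 = c₄ + 2 * v 1 * (v 0)⁻¹ * r := fun v hv => by
    rw [← symbols_relation_of_quartic hU hU0 hg hΓ hs hR hv 1, h₄ v hv, hr v hv]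
  have Γ100 : ∀ v ∈ U, Γ v 1 0 0 = c₄ - (v 0)⁻¹ * g v 0 1 := fun v hv => by
    linear_combination h₄ v hv - (rel hv).2
  have g00 : ∀ v ∈ U, g v 0 0 = (p - r) * v 0 + 2 * q * v 1 := fun v hv => by
    have h0 := hU0 v hv
    have e := (rel hv).1
    rw [Γ101 v hv, hr v hv] at e
    field_simp at e
    linear_combination -e
  have coord := fun (v : Pt) i => HasPartials.coord (v := v) i
  have C := fun (v : Pt) c => HasPartials.const (v := v) c
  have G := fun {v} (hv : v ∈ U) i j => hasPartials_of_smooth hU (hg i j) hv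
  have S := fun {v} (hv : v ∈ U) i j m => hasPartials_of_smooth hU (hΓ i j m) hv
  -- compare `∂g¹¹/∂u¹` computed from `g00` with the value `2 p` required by skewness
  obtain rfl : r = -p := by
    obtain ⟨v, hv⟩ := hUc.nonempty
    have e := ((((C v (p - r)).mul (coord v 0)).add ((C v (2 * q)).mul (coord v 1))).congr
      (Filter.mem_of_superset (hU.mem_nhds hv) fun w hw => (g00 w hw).symm)).2 0
    rw [hs.2 v hv, hp v hv] at e
    simp at e
    linarith
  -- the constants `c₃`, `c₆` and `c₅` are functions with zero gradient
  obtain ⟨c₃, h₃⟩ := exists_eq_const_of_partials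
    (f := fun v => v 0 * g v 0 1 - c₄ * (v 0 * v 0) - q * (v 1 * v 1))
    hU hUc fun v hv => ⟨_, (((coord v 0).mul (G hv 0 1)).sub ((C v c₄).mul ((coord v 0).mul
      (coord v 0)))).sub ((C v q).mul ((coord v 1).mul (coord v 1))), fun k => by
        have h0 := hU0 v hv
        simp only [hs.2 v hv]
        match k with
        | 0 => simp [h₄ v hv, Γ100 v hv]; field_simp; ring
        | 1 => simp [hr v hv, Γ101 v hv]; field_simp; ring⟩
  obtain ⟨c₆, h₆⟩ := exists_eq_const_of_partials (f := fun v => (-2) * (v 0 * v 0 * Γ v 1 1 0)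
      + 2 * p * (v 1 * v 1))
    hU hUc fun v hv => ⟨_, ((C v (-2)).mul (((coord v 0).mul (coord v 0)).mul (S hv 1 1 0))).add
      ((C v (2 * p)).mul ((coord v 1).mul (coord v 1))), fun k => by
        have h0 := hU0 v hv
        obtain ⟨-, e0, e1⟩ := pde hv 1
        rw [h₄ v hv, Γ111 v hv, hr v hv] at e0
        rw [hr v hv] at e1
        match k with
        | 0 =>
          simp
          linear_combination v 0 * e0
        | 1 => simp [e1]; field_simp; ring⟩
  obtain ⟨c₅, h₅⟩ := exists_eq_const_of_partials
    (f := fun v => g v 1 1 - 2 * c₄ * v 1 - c₆ * (v 0)⁻¹ + 2 * p * (v 1 * v 1) * (v 0)⁻¹)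
    hU hUc fun v hv => ⟨_, (((G hv 1 1).sub ((C v (2 * c₄)).mul (coord v 1))).sub
      ((C v c₆).mul ((coord v 0).inv (hU0 v hv)))).add
      (((C v (2 * p)).mul ((coord v 1).mul (coord v 1))).mul ((coord v 0).inv (hU0 v hv))),
      fun k => by
        have h0 := hU0 v hv
        simp only [hs.2 v hv]
        match k with
        | 0 => simp [← h₆ v hv]; field_simp; ring
        | 1 => simp [Γ111 v hv]; field_simp; ring⟩
  have g01 : ∀ v ∈ U, g v 0 1 = c₄ * v 0 + c₃ / v 0 + 2 * q * v 1 ^ 2 / (2 * v 0) := fun v hv => by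
    have h0 := hU0 v hv
    have e := h₃ v hv
    field_simp
    linear_combination e
  have g11 : ∀ v ∈ U, g v 1 1 = 2 * c₄ * v 1 + c₆ / v 0 - 2 * p * v 1 ^ 2 / v 0 + c₅ :=
    fun v hv => by
      have h0 := hU0 v hv
      have e := h₅ v hv
      field_simp at e ⊢
      linear_combination e
  have sym : ∀ v ∈ U, ∀ i j k, Γ v i j k = rationalSymbols (2 * p) (2 * q) c₃ c₄ c₆ v i j k :=
    fun v hv i j k => by
      have h0 := hU0 v hv
      have e := h₆ v hv
      fin_cases i <;> fin_cases j <;> fin_cases k <;>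
        simp [rationalSymbols, hp v hv, hq v hv, h₄ v hv, hr v hv, Γ101 v hv, Γ111 v hv, Γ100 v hv,
          g01 v hv]
      all_goals field_simp
      all_goals first | ring1 | linear_combination -e
  have quad := fun {v} (hv : v ∈ U) => symbols_mul_metric_of_schoutenCommute hU hg hΓ hs hH.2 hv
  have rel₁₂ : ∀ v ∈ U, (2 * q * c₆ + 2 * (2 * p) * c₃) + v 0 * (2 * q * c₅) = 0 := fun v hv => by
    have h0 := hU0 v hv
    have e := quad hv 0
    simp [sym v hv, rationalSymbols, hs.1 v hv 1 0, g00 v hv, g01 v hv, g11 v hv] at e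
    field_simp at e
    exact mul_left_cancel₀ h0 (by linear_combination 2 * e)
  obtain ⟨rel₁, rel₂⟩ := eq_zero_of_affine hU hUc.nonempty rel₁₂
  refine ⟨2 * p, 2 * q, c₃, c₄, c₅, c₆, fun v hv => ?_, g01, fun v hv => hs.1 v hv 1 0, g11, sym,
    rel₁, rel₂, ?_⟩
  · rw [g00 v hv]; ring
  obtain ⟨v, hv⟩ := hUc.nonempty
  have h0 := hU0 v hv
  have e := quad hv 1
  simp [sym v hv, rationalSymbols, hs.1 v hv 1 0, g00 v hv, g01 v hv, g11 v hv] at e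
  field_simp at e
  exact mul_left_cancel₀ (pow_ne_zero 2 h0) (by linear_combination -e + v 1 * rel₁)

lemma IsRational.hasRationalForm {c₁ c₂ c₃ c₄ c₅ c₆ : ℝ}
    (h : IsRational U g Γ c₁ c₂ c₃ c₄ c₅ c₆) : HasRationalForm U g :=
  ⟨c₁, c₂, c₃, c₄, c₅, c₆, fun v hv => ⟨h.g00 v hv, h.g01 v hv, h.g10 v hv, h.g11 v hv⟩,
    h.rel₁, h.rel₂, h.rel₃⟩

lemma HasRationalForm.exists_isRational (h : HasRationalForm U g) : ∃ c₁ c₂ c₃ c₄ c₅ c₆,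
    IsRational U g (rationalSymbols c₁ c₂ c₃ c₄ c₆) c₁ c₂ c₃ c₄ c₅ c₆ :=
  let ⟨c₁, c₂, c₃, c₄, c₅, c₆, h, r₁, r₂, r₃⟩ := h
  ⟨c₁, c₂, c₃, c₄, c₅, c₆, fun v hv => (h v hv).1, fun v hv => (h v hv).2.1,
    fun v hv => (h v hv).2.2.1, fun v hv => (h v hv).2.2.2, fun _ _ _ _ _ => rfl, r₁, r₂, r₃⟩

/-! ### Non-degenerate metrics -/

/-- For a non-degenerate metric, skewness is the condition `∇ g = 0` and the symmetry of `Γʲⁱₖ gᵏᵐ`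
in `j, m` is the absence of torsion. -/
lemma isLeviCivita_of_skewCoeffs (hdet : ∀ v ∈ U, (Matrix.of (g v)).det ≠ 0)
    (hs : SkewCoeffs U g Γ)
    (h : ∀ v ∈ U, ∀ i, ∑ k, Γ v 0 i k * g v k 1 = ∑ k, Γ v 1 i k * g v k 0) :
    IsLeviCivita U g Γ := by
  -- `C v j l k` is minus the product of the inverse of `g` with `Γ`
  let C : Pt → Fin 2 → Fin 2 → Fin 2 → ℝ := fun v j l k =>
    ![(g v 0 1 * Γ v 1 j k - g v 1 1 * Γ v 0 j k) / (g v 0 0 * g v 1 1 - g v 0 1 * g v 1 0),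
      (g v 1 0 * Γ v 0 j k - g v 0 0 * Γ v 1 j k) / (g v 0 0 * g v 1 1 - g v 0 1 * g v 1 0)] l
  refine ⟨hs.1, C, fun v hv => ?_⟩
  have hd : g v 0 0 * g v 1 1 - g v 0 1 * g v 1 0 ≠ 0 := by
    simpa [Matrix.det_fin_two] using hdet v hv
  have sol : ∀ i j k, Γ v i j k = -∑ l, g v i l * C v j l k := fun i j k => by
    simp only [C, Fin.sum_univ_two, Matrix.cons_val_zero, Matrix.cons_val_one,
      Matrix.cons_val_fin_one]
    generalize hD : g v 0 0 * g v 1 1 - g v 0 1 * g v 1 0 = D at hd ⊢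
    match i with
    | 0 => field_simp; rw [← hD]; ring
    | 1 => field_simp; rw [← hD]; ring
  have tor : ∀ j, C v j 0 1 = C v j 1 0 := fun j => by
    have e := h v hv j
    simp only [Fin.sum_univ_two] at e
    simp only [C, Matrix.cons_val_zero, Matrix.cons_val_one]
    congr 1
    linear_combination (Γ v 0 j 0 + Γ v 1 j 1) * hs.1 v hv 0 1 - e
  have sym : ∀ j l k, C v j l k = C v j k l := fun j l k => by
    match l, k with
    | 0, 0 => rfl
    | 0, 1 => exact tor j
    | 1, 0 => exact (tor j).symm
    | 1, 1 => rfl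
  refine ⟨sym, fun i j k => ?_, sol⟩
  have e := hs.2 v hv i j k
  rw [sol i j k, sol j i k] at e
  simp only [Fin.sum_univ_two, sym _ k] at e ⊢
  simp only [hs.1 v hv _ j] at e ⊢
  linear_combination e

lemma IsLeviCivita.skewCoeffs (h : IsLeviCivita U g Γ) : SkewCoeffs U g Γ := by
  obtain ⟨hg, C, hC⟩ := h
  refine ⟨hg, fun v hv i j k => ?_⟩
  obtain ⟨hsym, hnab, hΓ⟩ := hC v hv
  have e := hnab i j k
  simp only [hΓ, Fin.sum_univ_two, hsym _ 0 k, hsym _ 1 k, hg v hv j] at e ⊢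
  simp only [hg v hv _ j] at e ⊢
  linear_combination e

lemma IsLeviCivita.symbols_mul_metric (h : IsLeviCivita U g Γ) {v : Pt} (hv : v ∈ U) (i : Fin 2) :
    ∑ k, Γ v 0 i k * g v k 1 = ∑ k, Γ v 1 i k * g v k 0 := by
  obtain ⟨hg, C, hC⟩ := h
  obtain ⟨hsym, -, hΓ⟩ := hC v hv
  simp only [hΓ, Fin.sum_univ_two, hg v hv 1 0, hsym i 1 0]
  ring

/-- The symbols of a non-degenerate metric are determined by skewness and by the symmetry of
`Γʲⁱₖ gᵏᵐ`. -/
lemma symbols_unique (hdet : ∀ v ∈ U, (Matrix.of (g v)).det ≠ 0)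
    {Γ' : Pt → Fin 2 → Fin 2 → Fin 2 → ℝ} (hs : SkewCoeffs U g Γ) (hs' : SkewCoeffs U g Γ')
    (h : ∀ v ∈ U, ∀ i, ∑ k, Γ v 0 i k * g v k 1 = ∑ k, Γ v 1 i k * g v k 0)
    (h' : ∀ v ∈ U, ∀ i, ∑ k, Γ' v 0 i k * g v k 1 = ∑ k, Γ' v 1 i k * g v k 0)
    {v : Pt} (hv : v ∈ U) (i j k : Fin 2) : Γ v i j k = Γ' v i j k := by
  have hd : g v 0 0 * g v 1 1 - g v 0 1 * g v 1 0 ≠ 0 := by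
    simpa [Matrix.det_fin_two] using hdet v hv
  have e := fun i j k => (hs.2 v hv i j k).symm.trans (hs'.2 v hv i j k)
  have e0 := h v hv 0
  have e1 := h v hv 1
  have e0' := h' v hv 0
  have e1' := h' v hv 1
  simp only [Fin.sum_univ_two] at e0 e1 e0' e1'
  -- the difference of `Γ⁰¹` is a covector that the metric maps to zero
  have p0 : (Γ v 0 1 0 - Γ' v 0 1 0) * g v 0 0 + (Γ v 0 1 1 - Γ' v 0 1 1) * g v 1 0 = 0 := by
    linear_combination e0 - e0' - e 0 0 0 * g v 0 1 / 2 - e 0 0 1 * g v 1 1 / 2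
      + e 0 1 0 * g v 0 0 + e 0 1 1 * g v 1 0
  have p1 : (Γ v 0 1 0 - Γ' v 0 1 0) * g v 0 1 + (Γ v 0 1 1 - Γ' v 0 1 1) * g v 1 1 = 0 := by
    linear_combination e1 - e1' + e 1 1 0 * g v 0 0 / 2 + e 1 1 1 * g v 1 0 / 2
  have d0 : Γ v 0 1 0 = Γ' v 0 1 0 :=
    mul_left_cancel₀ hd (by linear_combination g v 1 1 * p0 - g v 1 0 * p1)
  have d1 : Γ v 0 1 1 = Γ' v 0 1 1 :=
    mul_left_cancel₀ hd (by linear_combination g v 0 0 * p1 - g v 0 1 * p0)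
  have := e 0 0 k
  have := e 1 1 k
  have := e 0 1 k
  fin_cases i <;> fin_cases j <;> fin_cases k <;> simp at * <;> linarith

end KdVType

end

theorem theorem3 (U : Set KdVType.Pt) (hUo : IsOpen U) (hUc : IsConnected U)
    (hU : ∀ v ∈ U, v 0 ≠ 0)
    (g : KdVType.Pt → Fin 2 → Fin 2 → ℝ) (hg : KdVType.SmoothMetric U g) :
    -- arbitrary (possibly degenerate) leading coefficient
    ((∃ Γ : KdVType.Pt → Fin 2 → Fin 2 → Fin 2 → ℝ,
        KdVType.SmoothSymbols U Γ ∧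
        KdVType.IsHamiltonian U (KdVType.firstOrderOp g Γ) ∧
        KdVType.SchoutenCommute U (KdVType.firstOrderOp g Γ) KdVType.thirdOrderOp) ↔
      KdVType.HasRationalForm U g) ∧
    -- non-degenerate leading coefficient: moreover the operator is determined by the metric
    ((∀ v ∈ U, (Matrix.of (g v)).det ≠ 0) →
      ∀ Γ : KdVType.Pt → Fin 2 → Fin 2 → Fin 2 → ℝ, KdVType.SmoothSymbols U Γ →
        ((KdVType.IsHamiltonian U (KdVType.firstOrderOp g Γ) ∧
          KdVType.SchoutenCommute U (KdVType.firstOrderOp g Γ) KdVType.thirdOrderOp) ↔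
        (KdVType.IsLeviCivita U g Γ ∧ KdVType.HasRationalForm U g))) := by
  have form : ∀ Γ, KdVType.SmoothSymbols U Γ → KdVType.IsHamiltonian U (KdVType.firstOrderOp g Γ) →
      KdVType.SchoutenCommute U (KdVType.firstOrderOp g Γ) KdVType.thirdOrderOp →
      KdVType.HasRationalForm U g := fun Γ hΓ hH hR => by
    obtain ⟨c₁, c₂, c₃, c₄, c₅, c₆, h⟩ := KdVType.exists_isRational hUo hUc hU hg hΓ hH hR
    exact h.hasRationalForm
  refine ⟨⟨fun ⟨Γ, hΓ, hH, hR⟩ => form Γ hΓ hH hR, fun h => ?_⟩, fun hdet Γ hΓ =>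
    ⟨fun ⟨hH, hR⟩ => ⟨?_, form Γ hΓ hH hR⟩, fun ⟨hL, hr⟩ => ?_⟩⟩
  · obtain ⟨c₁, c₂, c₃, c₄, c₅, c₆, h⟩ := h.exists_isRational
    have hΓ := KdVType.smoothSymbols_rationalSymbols hU c₁ c₂ c₃ c₄ c₆
    exact ⟨_, hΓ, h.isHamiltonian hUo hU hg hΓ, h.schoutenCommute hUo hU hg hΓ⟩
  · have hs := KdVType.skewCoeffs_of_isSkewAdjoint hUo hg hΓ hH.1
    exact KdVType.isLeviCivita_of_skewCoeffs hdet hs fun v hv =>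
      KdVType.symbols_mul_metric_of_schoutenCommute hUo hg hΓ hs hH.2 hv
  · obtain ⟨c₁, c₂, c₃, c₄, c₅, c₆, h⟩ := hr.exists_isRational
    have h' : KdVType.IsRational U g Γ c₁ c₂ c₃ c₄ c₅ c₆ :=
      { h with
        symbols := fun v hv => KdVType.symbols_unique hdet hL.skewCoeffs (h.skewCoeffs hUo hU)
          (fun v hv => hL.symbols_mul_metric hv) (fun v hv => h.symbols_mul_metric hU hv) hv }
    exact ⟨h'.isHamiltonian hUo hU hg hΓ, h'.schoutenCommute hUo hU hg hΓ⟩
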